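/- Let $p \ge 5$ be a prime. For a finite group $G$, let $\mu(G)$ be the least $n$ such that $G$ is isomorphic to a subgroup of the symmetric group $S_n$; call $G$ exceptional if it has a normal subgroup $N$ with $\mu(G/N) > \mu(G)$. Write $Z(G)$, $G'$ and $d(G)$ for the center, the commutator subgroup and the minimal number of generators of $G$. Call $G$ a VZ group if $\chi(g) = 0$ for all $g \in G \setminus Z(G)$ and all non-linear irreducible complex characters $\chi$ of $G$. Lemma. Let $G$ be a VZ group of order $p^6$. If $d(Z(G)) = d(G')$ and $|Z(G)| = p^2$, then $G$ is not exceptional. In particular, no group in $\Phi_{15}$ is exceptional. Here $\Phi_{15}$ consists of the groups of order $p^6$ that are isoclinic to the group with generators $\alpha_1, \alpha_2, \alpha_3, \alpha_4, \beta_1, \beta_2$ and defining relations $[\alpha_1,\alpha_2] = [\alpha_3,\alpha_4] = \beta_1$, $[\alpha_1,\alpha_3] = \beta_2$, $[\alpha_2,\alpha_4] = \beta_2^{\omega}$, $\alpha_i^p = \beta_j^p = 1$, all other commutators of generators being trivial, where $\omega$ is the smallest positive integer that is a primitive root modulo $p$. Groups $G$ and $H$ are isoclinic if there are isomorphisms $\varphi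 : G/Z(G) \to H/Z(H)$ and $\psi : G' \to H'$ such that $\psi([g_1,g_2]) = [h_1,h_2]$ whenever $\varphi(g_i Z(G)) = h_i Z(H)$ for $i = 1, 2$. -/

import Mathlib

open scoped commutatorElement

/-- The minimal faithful permutation degree `μ(G)`: the least `n` such that the (finite) group `G`
embeds in the symmetric group on `n` letters. -/
noncomputable def minFaithfulPermDegree (G : Type*) [Group G] : ℕ :=
  sInf {n : ℕ | ∃ f : G →* Equiv.Perm (Fin n), Function.Injective f}

/-- A finite group `G` is exceptional if `μ(G ⧸ N) > μ(G)` for some normal subgroup `N`. -/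
def IsExceptionalGroup (G : Type*) [Group G] : Prop :=
  ∃ (N : Subgroup G) (_ : N.Normal), minFaithfulPermDegree G < minFaithfulPermDegree (G ⧸ N)

/-- `G` is a VZ group: every nonlinear irreducible complex character vanishes off the center.
Every finite-dimensional complex representation is equivalent to one on some `ℂⁿ`. -/
def IsVZGroup (G : Type*) [Group G] : Prop :=
  ∀ (n : ℕ) (ρ : Representation ℂ G (Fin n → ℂ)), ρ.IsIrreducible → 1 < n →
    ∀ g : G, g ∉ Subgroup.center G → ρ.character g = 0

/-- Isoclinism in the sense of P. Hall: isomorphisms `G ⧸ Z(G) ≃* H ⧸ Z(H)` and `G' ≃* H'` that are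
compatible with the commutator maps. -/
def IsIsoclinic (G H : Type*) [Group G] [Group H] : Prop :=
  ∃ (φ : G ⧸ Subgroup.center G ≃* H ⧸ Subgroup.center H) (ψ : commutator G ≃* commutator H),
    ∀ (g₁ g₂ : G) (h₁ h₂ : H),
      φ (QuotientGroup.mk g₁) = QuotientGroup.mk h₁ →
      φ (QuotientGroup.mk g₂) = QuotientGroup.mk h₂ →
      (ψ ⟨⁅g₁, g₂⁆, Subgroup.commutator_mem_commutator (Subgroup.mem_top g₁)
        (Subgroup.mem_top g₂)⟩ : H) = ⁅h₁, h₂⁆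

/-- The smallest positive integer that is a primitive root modulo the prime `p`. -/
noncomputable def leastPrimitiveRoot (p : ℕ) : ℕ :=
  sInf {w : ℕ | 0 < w ∧ IsPrimitiveRoot (w : ZMod p) (p - 1)}

namespace Phi15

/-- The free generators `α₁, α₂, α₃, α₄`, indexed from `0`. -/
def α (i : Fin 4) : FreeGroup (Fin 4 ⊕ Fin 2) := FreeGroup.of (Sum.inl i)

/-- The free generators `β₁, β₂`, indexed from `0`. -/
def β (j : Fin 2) : FreeGroup (Fin 4 ⊕ Fin 2) := FreeGroup.of (Sum.inr j)

/-- The relators of `Φ₁₅(1⁶)`: with `ω` the least primitive root modulo `p`, the relations are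
`[α₁, α₂] = [α₃, α₄] = β₁`, `[α₁, α₃] = β₂`, `[α₂, α₄] = β₂ ^ ω`, all other commutators of
generators are trivial, and all generators have `p`-th power `1`. -/
def relators (p : ℕ) : Set (FreeGroup (Fin 4 ⊕ Fin 2)) :=
  {⁅α 0, α 1⁆ * (β 0)⁻¹, ⁅α 2, α 3⁆ * (β 0)⁻¹, ⁅α 0, α 2⁆ * (β 1)⁻¹,
    ⁅α 1, α 3⁆ * (β 1 ^ leastPrimitiveRoot p)⁻¹, ⁅α 0, α 3⁆, ⁅α 1, α 2⁆, ⁅β 0, β 1⁆} ∪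
  {r | ∃ i j, r = ⁅α i, β j⁆} ∪ {r | ∃ i, r = α i ^ p} ∪ {r | ∃ j, r = β j ^ p}

/-- The group `Φ₁₅(1⁶)`. -/
abbrev StemGroup (p : ℕ) : Type := PresentedGroup (relators p)

end Phi15

/-- `G` is one of the groups of order `p ^ 6` in the isoclinism family `Φ₁₅`, the family
of the group `Φ₁₅(1⁶)`. -/
def IsInPhi15 (p : ℕ) (G : Type*) [Group G] : Prop :=
  Nat.card G = p ^ 6 ∧ IsIsoclinic G (Phi15.StemGroup p)

/-!
Let `G` have order `p ^ 6`, centre `Z` of order `p ^ 2` and derived subgroup `1 ≠ G' ≤ Z`, and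
suppose that `[g, G] = G'`, as a set of commutators, for every `g ∉ Z`. The proof shows that
`μ(G ⧸ N) ≤ p ^ 3 ≤ μ(G)` for every nontrivial normal subgroup `N`.

For the lower bound (`pow_three_le_index`), a faithful permutation action has a point stabilizer
`H` that does not contain `G'`. Then `Z ≰ H`, so `|H ∩ Z| ≤ p`. If `HZ` had index at most `p`, then
`G = ⟨HZ, x⟩` for some `x`, and the kernel of `h ↦ [x, h]` on `HZ` would be too large to be central,
so it would provide some `k ∈ H` outside `Z` with `[k, G] ≤ H`, against `[k, G] = G'`. Hence
`|HZ| ≤ p ^ 4`, `|H| ≤ p ^ 3`, and the orbit has length at least `p ^ 3`.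

For the upper bound, a normal subgroup that is not central contains some `[g, G] = G'`.
If `G' ≤ N`, then `G ⧸ N` is abelian of order at most `p ^ 5` and exponent dividing `p ^ 2`, hence a
product of at most five cyclic groups of order at most `p ^ 2`, which gives
`μ(G ⧸ N) ≤ 5 p ^ 2 ≤ p ^ 3`. Otherwise `N` is central of order `p`. When `|G'| = p` the centre is
cyclic by the rank hypothesis, which forces `N = G'`; so `G' = Z`, and `G ⧸ N` has order `p ^ 5`,
class two and centre of order `p`. Such a group contains an elementary abelian subgroup of order
`p ^ 2` meeting the centre trivially (`minFaithfulPermDegree_le_of_card_center_eq_prime`), and acts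
faithfully on its cosets, at most `p ^ 3` in number.

It remains to verify the hypotheses. For a VZ group, elements on which all irreducible characters
agree are conjugate (`isConj_of_forall_character_eq`), so `g` is conjugate to `g z` whenever
`z ∈ G'` and `g`, `g z` are not central; a count of `p`-powers then gives `G' ≤ Z`. For the family
`Φ₁₅`, the hypotheses are invariant under isoclinism, and they are checked for the presented group
by identifying it with an explicit group on `𝔽_p ^ 6`; there `[g, G] = G'` holds because the form
`x² - ω y²` is anisotropic, `ω` being a non-square.
-/

/-! ### Minimal faithful permutation degrees -/

/-- The set in the definition of the minimal degree is nonempty, so the infimum is attained. -/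
theorem exists_injective_hom_perm_minFaithfulPermDegree (G : Type*) [Group G] [Finite G] :
    ∃ f : G →* Equiv.Perm (Fin (minFaithfulPermDegree G)), Function.Injective f := by
  have hne : {n : ℕ | ∃ f : G →* Equiv.Perm (Fin n), Function.Injective f}.Nonempty := by
    refine ⟨Nat.card G, ((Finite.equivFin G).permCongrHom.toMonoidHom).comp
      (MulAction.toPermHom G G), ?_⟩
    exact (Finite.equivFin G).permCongrHom.injective.comp MulAction.toPerm_injective
  exact Nat.sInf_mem hne

theorem minFaithfulPermDegree_le_card {G α : Type*} [Group G] [Finite α]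
    (f : G →* Equiv.Perm α) (hf : Function.Injective f) :
    minFaithfulPermDegree G ≤ Nat.card α :=
  Nat.sInf_le ⟨((Finite.equivFin α).permCongrHom.toMonoidHom).comp f,
    (Finite.equivFin α).permCongrHom.injective.comp hf⟩

theorem minFaithfulPermDegree_le_of_injective {G H : Type*} [Group G] [Group H] [Finite H]
    (f : G →* H) (hf : Function.Injective f) :
    minFaithfulPermDegree G ≤ minFaithfulPermDegree H := by
  obtain ⟨F, hF⟩ := exists_injective_hom_perm_minFaithfulPermDegree H
  exact Nat.sInf_le ⟨F.comp f, hF.comp hf⟩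

/-- A core-free subgroup gives a faithful transitive action on its cosets. -/
theorem minFaithfulPermDegree_le_index {G : Type*} [Group G] [Finite G] (H : Subgroup G)
    (hH : H.normalCore = ⊥) : minFaithfulPermDegree G ≤ H.index := by
  refine minFaithfulPermDegree_le_card (MulAction.toPermHom G (G ⧸ H)) ?_
  rw [← MonoidHom.ker_eq_bot_iff, ← Subgroup.normalCore_eq_ker, hH]

/-- In a faithful action some point stabilizer does not contain a given nontrivial subgroup `C`,
and the degree is at least the length of the orbit of that point. -/
theorem le_minFaithfulPermDegree {G : Type*} [Group G] [Finite G] (C : Subgroup G) (hC : C ≠ ⊥)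
    (n : ℕ) (h : ∀ H : Subgroup G, ¬ C ≤ H → n ≤ H.index) :
    n ≤ minFaithfulPermDegree G := by
  obtain ⟨f, hf⟩ := exists_injective_hom_perm_minFaithfulPermDegree G
  obtain ⟨c, hc, hc1⟩ := C.bot_or_exists_ne_one.resolve_left hC
  have hfc : f c ≠ 1 := fun h0 => hc1 (hf (by rw [h0, map_one]))
  obtain ⟨x, hx⟩ : ∃ x, f c x ≠ x := by
    by_contra! hall
    exact hfc (Equiv.ext hall)
  let := MulAction.compHom (Fin (minFaithfulPermDegree G)) f
  calc n ≤ (MulAction.stabilizer G x).index := h _ fun hle => hx (hle hc)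
    _ = (MulAction.orbit G x).ncard := MulAction.index_stabilizer G x
    _ ≤ Nat.card (Fin (minFaithfulPermDegree G)) := Set.ncard_le_card _
    _ = _ := Nat.card_fin _

/-- A finite abelian `p`-group of order dividing `p ^ k` and exponent dividing `p ^ 2` is a product
of at most `k` cyclic groups of order at most `p ^ 2`, and acts on the disjoint union of them. -/
theorem minFaithfulPermDegree_le_of_comm {p : ℕ} (hp : p.Prime) {A : Type*} [CommGroup A] [Finite A]
    {k : ℕ} (hA : Nat.card A ∣ p ^ k) (hexp : ∀ a : A, a ^ p ^ 2 = 1) :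
    minFaithfulPermDegree A ≤ k * p ^ 2 := by
  obtain ⟨ι, _, n, hn, ⟨e⟩⟩ := CommGroup.equiv_prod_multiplicative_zmod_of_finite A
  classical
  have (i : ι) : NeZero (n i) := ⟨by have := hn i; omega⟩
  -- A generator of the `i`-th factor has order `n i`.
  have hdvd (i : ι) : n i ∣ p ^ 2 := by
    have h1 := hexp (e.symm (Pi.mulSingle i (Multiplicative.ofAdd 1)))
    rw [← map_pow, map_eq_one_iff _ e.symm.injective, ← Pi.mulSingle_pow, Pi.mulSingle_eq_one_iff,
      ← ofAdd_nsmul, ofAdd_eq_one, nsmul_one] at h1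
    exact (ZMod.natCast_eq_zero_iff _ _).1 h1
  have hcard : ∏ i, n i ∣ p ^ k := by
    rw [Nat.card_congr e.toEquiv, Nat.card_pi] at hA
    simpa using hA
  have hι : Fintype.card ι ≤ k := by
    refine (Nat.pow_dvd_pow_iff_le_right hp.one_lt).1 (dvd_trans ?_ hcard)
    rw [← Finset.card_univ, ← Finset.prod_const]
    refine Finset.prod_dvd_prod_of_dvd _ _ fun i _ => ?_
    obtain ⟨j, -, hj⟩ := (Nat.dvd_prime_pow hp).1 (hdvd i)
    have := hn i
    rw [hj] at this ⊢
    exact dvd_pow_self _ (by rintro rfl; simp at this)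
  let F : ((i : ι) → Multiplicative (ZMod (n i))) →*
      Equiv.Perm (Σ i, Multiplicative (ZMod (n i))) :=
    (Equiv.Perm.sigmaCongrRightHom _).comp
      (MonoidHom.piMap fun i => MulAction.toPermHom (Multiplicative (ZMod (n i)))
        (Multiplicative (ZMod (n i))))
  have hF : Function.Injective F := by
    refine Equiv.Perm.sigmaCongrRightHom_injective.comp ?_
    intro a b hab
    funext i
    exact MulAction.toPerm_injective (congrFun hab i)
  calc _ ≤ Nat.card (Σ i, Multiplicative (ZMod (n i))) :=
        minFaithfulPermDegree_le_card (F.comp e.toMonoidHom) (hF.comp e.injective)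
    _ = ∑ i, n i := by simp
    _ ≤ ∑ _i : ι, p ^ 2 :=
        Finset.sum_le_sum fun i _ => Nat.le_of_dvd (pow_pos hp.pos 2) (hdvd i)
    _ = Fintype.card ι * p ^ 2 := by simp
    _ ≤ _ := by gcongr

/-! ### Characters and VZ groups -/

open scoped MonoidAlgebra

/-- A simple `ℂ[G]`-module of finite dimension is, in coordinates, an irreducible representation on
some `ℂⁿ`. -/
theorem exists_irreducible_representation_of_isSimpleModule {G M : Type*} [Group G]
    [AddCommGroup M] [Module ℂ M] [Module ℂ[G] M] [IsScalarTower ℂ ℂ[G] M]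
    [FiniteDimensional ℂ M] [IsSimpleModule ℂ[G] M] :
    ∃ (n : ℕ) (ρ : Representation ℂ G (Fin n → ℂ)) (e : M ≃ₗ[ℂ] (Fin n → ℂ)), ρ.IsIrreducible ∧
      ∀ x m, ρ.asAlgebraHom x (e m) = e (x • m) := by
  let e : M ≃ₗ[ℂ] (Fin (Module.finrank ℂ M) → ℂ) := (Module.finBasis ℂ M).equivFun
  let F : ℂ[G] →ₐ[ℂ] Module.End ℂ (Fin (Module.finrank ℂ M) → ℂ) :=
    (e.conjAlgEquiv ℂ : _ →ₐ[ℂ] _).comp (Algebra.lsmul ℂ ℂ M)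
  let ρ : Representation ℂ G (Fin (Module.finrank ℂ M) → ℂ) := (MonoidAlgebra.lift ℂ _ G).symm F
  have hF : ρ.asAlgebraHom = F := (MonoidAlgebra.lift ℂ _ G).apply_symm_apply F
  have hρ : ∀ x m, ρ.asAlgebraHom x (e m) = e (x • m) := by
    intro x m
    rw [hF]
    simp [F]
  refine ⟨_, ρ, e, ?_, hρ⟩
  rw [Representation.irreducible_iff_isSimpleModule_asModule]
  let E : M ≃ₗ[ℂ[G]] ρ.asModule :=
    { e.toAddEquiv.trans ρ.asModuleEquiv.symm.toAddEquiv with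
      map_smul' := fun x m => by
        apply ρ.asModuleEquiv.injective
        simpa using (hρ x m).symm }
  exact IsSimpleModule.congr E.symm

/-- A semisimple ring is the sum of its simple left ideals. -/
theorem eq_zero_of_smul_eq_zero_of_isSimpleModule {R : Type*} [Ring R] [IsSemisimpleRing R] (x : R)
    (h : ∀ S : Submodule R R, IsSimpleModule R S → ∀ s ∈ S, x * s = 0) : x = 0 := by
  have key : ∀ s : R, x * s = 0 := by
    intro s
    have hs : s ∈ sSup {S : Submodule R R | IsSimpleModule R S} := by
      rw [IsSemisimpleModule.sSup_simples_eq_top]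
      trivial
    rw [sSup_eq_iSup'] at hs
    induction hs using Submodule.iSup_induction' with
    | mem S s hs => exact h S.1 S.2 s hs
    | zero => exact mul_zero x
    | add a b _ _ ha hb => rw [mul_add, ha, hb, add_zero]
  simpa using key 1

/-- Irreducible characters separate conjugacy classes. The difference of the two averaged class sums
is central in `ℂ[G]`, so by Schur's lemma it acts on every simple module by a scalar; its trace, a
difference of character values, is zero, hence so is the element, by Maschke's theorem. -/
theorem isConj_of_forall_character_eq {G : Type*} [Group G] [Finite G] (g g' : G)
    (h : ∀ (n : ℕ) (ρ : Representation ℂ G (Fin n → ℂ)), ρ.IsIrreducible →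
      ρ.character g = ρ.character g') : IsConj g g' := by
  classical
  have := Fintype.ofFinite G
  have : FiniteDimensional ℂ ℂ[G] := Module.Finite.equiv (MonoidAlgebra.coeffLinearEquiv ℂ).symm
  let D (a : G) : ℂ[G] := ∑ t : G, MonoidAlgebra.of ℂ G (t * a * t⁻¹)
  have hD (a b : G) : MonoidAlgebra.of ℂ G b * D a = D a * MonoidAlgebra.of ℂ G b := by
    simp only [D, Finset.mul_sum, Finset.sum_mul, ← map_mul]
    refine Fintype.sum_equiv (Equiv.mulLeft b) _ _ fun t => ?_
    simp [mul_assoc]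
  have hx : D g - D g' = 0 := by
    refine eq_zero_of_smul_eq_zero_of_isSimpleModule _ fun S hS s hs => ?_
    obtain ⟨n, ρ, e, hρ, he⟩ :=
      exists_irreducible_representation_of_isSimpleModule (G := G) (M := S)
    have hcomm : ∀ y : ℂ[G], y * (D g - D g') = (D g - D g') * y := by
      intro y
      induction y using MonoidAlgebra.induction_on with
      | of b => rw [mul_sub, sub_mul, hD, hD]
      | add a b ha hb => rw [add_mul, mul_add, ha, hb]
      | smul r a ha => rw [smul_mul_assoc, mul_smul_comm, ha]
    let f : Module.End ℂ[G] S :=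
      { toFun := fun m => (D g - D g') • m
        map_add' := fun _ _ => smul_add _ _ _
        map_smul' := fun y m => by
          rw [smul_smul, ← hcomm, ← smul_smul]; rfl }
    obtain ⟨c, hc⟩ := (IsSimpleModule.algebraMap_end_bijective_of_isAlgClosed
      (A := ℂ[G]) (V := S) ℂ).2 f
    have hc' : ∀ m : S, (D g - D g') • m = c • m := fun m => (congrArg (· m) hc).symm
    -- In characteristic zero the scalar `c` vanishes once the trace `c * n` does, as `n ≠ 0`.
    have hρD : ρ.asAlgebraHom (D g - D g') = c • 1 := by
      refine LinearMap.ext fun m => ?_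
      obtain ⟨m, rfl⟩ := e.surjective m
      rw [he, hc']
      simp
    have htr (a : G) : LinearMap.trace ℂ _ (ρ.asAlgebraHom (D a)) =
        Fintype.card G * ρ.character a := by
      have (t : G) : LinearMap.trace ℂ _ (ρ (t * a * t⁻¹)) = ρ.character a := by
        rw [map_mul ρ, LinearMap.trace_mul_comm, ← map_mul ρ, inv_mul_cancel_left]
        rfl
      simp only [D, map_sum, Representation.asAlgebraHom_of, this]
      simp
    have hc0 : c * n = 0 := by
      have := congrArg (LinearMap.trace ℂ _) hρD
      simpa [map_sub, htr, h n ρ hρ] using this.symm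
    have key := hc' ⟨s, hs⟩
    rcases mul_eq_zero.1 hc0 with hc0 | hn
    · rw [hc0, zero_smul] at key
      exact congrArg Subtype.val key
    · obtain rfl : n = 0 := by exact_mod_cast hn
      have : Subsingleton S := e.toEquiv.subsingleton
      have : (⟨s, hs⟩ : S) = 0 := Subsingleton.elim _ _
      rw [show s = 0 from congrArg Subtype.val this, mul_zero]
  have hcoeff (a : G) : (D a).coeff g ≠ 0 ↔ IsConj a g := by
    have : (D a).coeff g = ((Finset.univ.filter fun t : G => t * a * t⁻¹ = g).card : ℂ) := by
      simp [D, MonoidAlgebra.coeff_sum, Finsupp.single_apply, Finset.sum_boole]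
    rw [this, Nat.cast_ne_zero, Finset.card_ne_zero, isConj_iff]
    simp [Finset.Nonempty]
  exact ((hcoeff g').1 (sub_eq_zero.1 hx ▸ (hcoeff g).2 (IsConj.refl g))).symm

/-- All irreducible characters agree on `g` and `g * z`: the linear ones kill `z`, and the others
vanish on both elements. -/
theorem IsVZGroup.isConj_mul {G : Type*} [Group G] [Finite G] (hG : IsVZGroup G) {g z : G}
    (hg : g ∉ Subgroup.center G) (hz : z ∈ commutator G) (hgz : g * z ∉ Subgroup.center G) :
    IsConj g (g * z) := by
  refine isConj_of_forall_character_eq _ _ fun n ρ hρ => ?_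
  rcases lt_trichotomy n 1 with hn | rfl | hn
  · obtain rfl : n = 0 := by omega
    simp [Representation.character, Subsingleton.elim (ρ g) 0, Subsingleton.elim (ρ (g * z)) 0]
  · -- Endomorphisms of `ℂ¹` commute, so `ρ` is trivial on the derived subgroup.
    have hcomm (a b : Module.End ℂ (Fin 1 → ℂ)) : a * b = b * a := by
      have hsc (f : Module.End ℂ (Fin 1 → ℂ)) (v : Fin 1 → ℂ) : f v = f 1 0 • v := by
        have hv (w : Fin 1 → ℂ) : w = w 0 • (1 : Fin 1 → ℂ) := by
          ext i
          simp [Subsingleton.elim i 0]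
        conv_lhs => rw [hv v, map_smul, hv (f 1)]
        conv_rhs => rw [hv v]
        rw [smul_smul, smul_smul, mul_comm]
      refine LinearMap.ext fun v => ?_
      simp only [Module.End.mul_apply]
      rw [hsc a (b v), hsc b v, hsc b (a v), hsc a v, smul_smul, smul_smul, mul_comm]
    have hker : commutator G ≤ ρ.ker := by
      rw [commutator_def, Subgroup.commutator_le]
      intro a _ b _
      rw [MonoidHom.mem_ker, commutatorElement_def, map_mul, map_mul, map_mul, hcomm (ρ a)]
      simp only [← map_mul]
      simp
    rw [Representation.character, Representation.character, map_mul, hker hz, mul_one]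
  · rw [hG n ρ hρ hn g hg, hG n ρ hρ hn _ hgz]

/-- If `G'` were not central, `G' \ Z` would be a single conjugacy class, so its size
`p ^ a - p ^ b` would be a power of `p`, against parity. -/
theorem IsVZGroup.commutator_le_center {p : ℕ} (hp : p.Prime) (hp3 : 3 ≤ p) {G : Type*} [Group G]
    [Finite G] (hpG : IsPGroup p G) (hG : IsVZGroup G) : commutator G ≤ Subgroup.center G := by
  have := Fact.mk hp
  by_contra hle
  obtain ⟨z, hz, hzc⟩ := SetLike.not_le_iff_exists.1 hle
  have hclass : {x | IsConj z x} = (commutator G : Set G) \ Subgroup.center G := by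
    ext x
    constructor
    · intro hx
      obtain ⟨c, rfl⟩ := isConj_iff.1 hx
      refine ⟨(inferInstance : (commutator G).Normal).conj_mem z hz c, fun h => hzc ?_⟩
      simpa [mul_assoc] using
        (inferInstance : (Subgroup.center G).Normal).conj_mem _ h c⁻¹
    · rintro ⟨hx, hxc⟩
      have := hG.isConj_mul hzc (mul_mem (inv_mem hz) hx) (by simpa using hxc)
      simpa using this
  obtain ⟨k, hk⟩ : ∃ k, {x | IsConj z x}.ncard = p ^ k := by
    obtain ⟨k, hk⟩ := (hpG.of_equiv ConjAct.toConjAct).card_orbit z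
    refine ⟨k, hk ▸ congrArg Set.ncard ?_⟩
    ext x
    rw [ConjAct.mem_orbit_conjAct, isConj_comm]
    rfl
  obtain ⟨a, ha⟩ := IsPGroup.iff_card.1 (hpG.to_subgroup (commutator G))
  obtain ⟨b, hb⟩ := IsPGroup.iff_card.1 (hpG.to_subgroup (commutator G ⊓ Subgroup.center G))
  have hsum : p ^ k + p ^ b = p ^ a := by
    rw [← hk, ← ha, ← hb, hclass]
    have := Set.ncard_sdiff_add_ncard_of_subset
      (s := (commutator G ⊓ Subgroup.center G : Subgroup G))
      (t := (commutator G : Set G)) inf_le_left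
    rw [Subgroup.coe_inf, Set.sdiff_self_inter] at this
    exact this
  have hodd : Odd p := hp.odd_of_ne_two (by omega)
  exact Nat.not_even_iff_odd.2 hodd.pow (hsum ▸ hodd.pow.add_odd hodd.pow)

theorem IsVZGroup.exists_commutatorElement_eq {p : ℕ} (hp : p.Prime) (hp3 : 3 ≤ p) {G : Type*}
    [Group G] [Finite G] (hpG : IsPGroup p G) (hG : IsVZGroup G) {g z : G}
    (hg : g ∉ Subgroup.center G) (hz : z ∈ commutator G) : ∃ y, ⁅g, y⁆ = z := by
  have hle := hG.commutator_le_center hp hp3 hpG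
  have hgz : g * z⁻¹ ∉ Subgroup.center G := fun h =>
    hg (by simpa using mul_mem h (hle hz))
  obtain ⟨y, hy⟩ := isConj_iff.1 (hG.isConj_mul hg (inv_mem hz) hgz)
  refine ⟨y, ?_⟩
  have h1 : y * g⁻¹ * y⁻¹ = z * g⁻¹ := by
    rw [← inv_inj]
    simpa [mul_assoc] using hy
  rw [commutatorElement_def, mul_assoc, mul_assoc, ← mul_assoc y, h1,
    ← Subgroup.mem_center_iff.1 (hle hz), mul_inv_cancel_left]

/-! ### Stabilizers in groups of class two -/

/-- The homomorphism `y ↦ ⁅x, y⁆` of a group of class at most two into its centre. -/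
def commutatorHom {G : Type*} [Group G] (hG : commutator G ≤ Subgroup.center G) (x : G) :
    G →* Subgroup.center G where
  toFun y := ⟨⁅x, y⁆, hG (Subgroup.commutator_mem_commutator (Subgroup.mem_top x)
    (Subgroup.mem_top y))⟩
  map_one' := by simp
  map_mul' a b := by
    have hb : ⁅x, b⁆ ∈ Subgroup.center G := hG (Subgroup.commutator_mem_commutator
      (Subgroup.mem_top x) (Subgroup.mem_top b))
    ext
    simp only [Subgroup.coe_mul]
    rw [commutatorElement_mul_right_eq_mul_conj, Subgroup.mem_center_iff.1 hb, mul_assoc, mul_assoc,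
      mul_inv_cancel, mul_one]
    exact (Subgroup.mem_center_iff.1 hb _).symm

@[simp]
theorem coe_commutatorHom {G : Type*} [Group G] (hG : commutator G ≤ Subgroup.center G) (x y : G) :
    (commutatorHom hG x y : G) = ⁅x, y⁆ := rfl

theorem commutatorElement_pow_right {G : Type*} [Group G]
    (hG : commutator G ≤ Subgroup.center G) (x y : G) (n : ℕ) : ⁅x, y ^ n⁆ = ⁅x, y⁆ ^ n :=
  congrArg Subtype.val (map_pow (commutatorHom hG x) y n)

theorem commutatorElement_pow_left {G : Type*} [Group G]
    (hG : commutator G ≤ Subgroup.center G) (x y : G) (n : ℕ) : ⁅x ^ n, y⁆ = ⁅x, y⁆ ^ n := by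
  rw [← commutatorElement_inv, commutatorElement_pow_right hG, ← inv_pow, commutatorElement_inv]

theorem card_eq_card_mul_relIndex {G : Type*} [Group G] {H K : Subgroup G} (h : H ≤ K) :
    Nat.card K = Nat.card H * H.relIndex K := by
  rw [← Subgroup.relIndex_bot_left, ← Subgroup.relIndex_bot_left,
    Subgroup.relIndex_mul_relIndex _ _ _ bot_le h]

/-- A subgroup `H` with `HZ` of index at most `p` contains a non-central element `k` with
`[k, G] ≤ H`. -/
theorem exists_mem_forall_commutatorElement_mem {p : ℕ} (hp : p.Prime) {G : Type*} [Group G]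
    [Finite G] (hG : Nat.card G = p ^ 6) (hZ : Nat.card (Subgroup.center G) = p ^ 2)
    (hle : commutator G ≤ Subgroup.center G) (H : Subgroup G)
    (hH : (H ⊔ Subgroup.center G).index ∣ p) :
    ∃ k ∈ H, k ∉ Subgroup.center G ∧ ∀ y, ⁅k, y⁆ ∈ H := by
  obtain ⟨x, hx⟩ : ∃ x, (H ⊔ Subgroup.center G) ⊔ Subgroup.zpowers x = ⊤ := by
    rcases (Nat.dvd_prime hp).1 hH with h1 | h1
    · exact ⟨1, by rw [Subgroup.index_eq_one.1 h1, top_sup_eq]⟩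
    · obtain ⟨x, hx⟩ : ∃ x, x ∉ H ⊔ Subgroup.center G := by
        by_contra! hall
        rw [(Subgroup.eq_top_iff' _).2 hall, Subgroup.index_top] at h1
        exact hp.one_lt.ne h1
      refine ⟨x, ?_⟩
      set N := H ⊔ Subgroup.center G
      have h2 := Subgroup.relIndex_mul_index (le_sup_left : N ≤ N ⊔ Subgroup.zpowers x)
      rw [← Subgroup.index_eq_one]
      refine ((Nat.dvd_prime hp).1 (h1 ▸ Dvd.intro_left _ h2)).resolve_right fun h3 => hx ?_
      rw [h3, h1] at h2
      have h4 := Subgroup.relIndex_eq_one.1 ((mul_eq_right₀ hp.ne_zero).1 h2)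
      exact h4 (Subgroup.mem_sup_right (Subgroup.mem_zpowers x))
  -- The kernel of `⁅x, -⁆` on `HZ` has order at least `p ^ 3`, hence is not central.
  obtain ⟨k', hk', hk'Z⟩ : ∃ k ∈ (H ⊔ Subgroup.center G) ⊓ (commutatorHom hle x).ker,
      k ∉ Subgroup.center G := by
    by_contra! hall
    have h1 := Subgroup.card_le_of_le (show _ ≤ Subgroup.center G from hall)
    have h2 : ((H ⊔ Subgroup.center G) ⊓ (commutatorHom hle x).ker).index ≤ p * p ^ 2 :=
      (Subgroup.index_inf_le ..).trans (Nat.mul_le_mul (Nat.le_of_dvd hp.pos hH)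
        (by rw [Subgroup.index_ker, ← hZ]; exact Subgroup.card_le_card_group _))
    have h3 := ((H ⊔ Subgroup.center G) ⊓ (commutatorHom hle x).ker).card_mul_index
    rw [hG] at h3
    have h4 : p ^ 6 ≤ p ^ 2 * (p * p ^ 2) := h3 ▸ Nat.mul_le_mul (hZ ▸ h1) h2
    rw [show p ^ 2 * (p * p ^ 2) = p ^ 5 by ring] at h4
    exact absurd h4 (not_le.2 (Nat.pow_lt_pow_right hp.one_lt (by norm_num)))
  obtain ⟨k, hk, z, hz, rfl⟩ := Subgroup.mem_sup_of_normal_right.1 hk'.1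
  have hkZ : k ∉ Subgroup.center G := fun h => hk'Z (mul_mem h hz)
  have hxk : ⁅k, x⁆ = 1 := by
    have h1 := congrArg Subtype.val (MonoidHom.mem_ker.1 hk'.2)
    have h2 : ⁅x, z⁆ = 1 :=
      commutatorElement_eq_one_iff_mul_comm.2 (Subgroup.mem_center_iff.1 hz x)
    rw [map_mul, Subgroup.coe_mul, coe_commutatorHom, coe_commutatorHom, h2, mul_one] at h1
    rw [← commutatorElement_inv, h1]
    simp
  refine ⟨k, hk, hkZ, fun y => ?_⟩
  -- `{y | ⁅k, y⁆ ∈ H}` is a subgroup containing `H`, the centre and `x`.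
  have hall : (H ⊔ Subgroup.center G) ⊔ Subgroup.zpowers x ≤
      (H.subgroupOf (Subgroup.center G)).comap (commutatorHom hle k) := by
    refine sup_le (sup_le (fun h hh => ?_) fun z hz => ?_) (Subgroup.zpowers_le.2 ?_)
    · change ⁅k, h⁆ ∈ H
      exact mul_mem (mul_mem (mul_mem hk hh) (inv_mem hk)) (inv_mem hh)
    · change ⁅k, z⁆ ∈ H
      rw [commutatorElement_eq_one_iff_mul_comm.2 (Subgroup.mem_center_iff.1 hz k)]
      exact one_mem H
    · change ⁅k, x⁆ ∈ H
      rw [hxk]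
      exact one_mem H
  exact hall (hx ▸ Subgroup.mem_top y)

/-- Here `|HZ| ≤ p ^ 4` and `|H ∩ Z| ≤ p`, so that `|H| = |HZ| |H ∩ Z| / |Z| ≤ p ^ 3`. -/
theorem pow_three_le_index {p : ℕ} (hp : p.Prime) {G : Type*} [Group G] [Finite G]
    (hG : Nat.card G = p ^ 6) (hZ : Nat.card (Subgroup.center G) = p ^ 2)
    (hle : commutator G ≤ Subgroup.center G)
    (hcomm : ∀ g ∉ Subgroup.center G, ∀ z ∈ commutator G, ∃ y, ⁅g, y⁆ = z)
    (H : Subgroup G) (hH : ¬ commutator G ≤ H) : p ^ 3 ≤ H.index := by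
  have hi : p ^ 2 ≤ (H ⊔ Subgroup.center G).index := by
    obtain ⟨j, -, hj⟩ := (Nat.dvd_prime_pow hp).1 (hG ▸ (H ⊔ Subgroup.center G).index_dvd_card)
    rw [hj]
    refine Nat.pow_le_pow_right hp.pos ?_
    by_contra! hj2
    obtain ⟨k, hk, hkZ, hkH⟩ := exists_mem_forall_commutatorElement_mem hp hG hZ hle H
      (by rw [hj]; exact pow_dvd_pow p (show j ≤ 1 by omega) |>.trans (pow_one p).dvd)
    exact hH fun z hz => by
      obtain ⟨y, rfl⟩ := hcomm k hkZ z hz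
      exact hkH y
  have hc : Nat.card (Subgroup.center G ⊓ H : Subgroup G) ≤ p := by
    obtain ⟨j, hj, hj'⟩ := (Nat.dvd_prime_pow hp).1 (hZ ▸ Subgroup.card_dvd_of_le
      (inf_le_left : Subgroup.center G ⊓ H ≤ Subgroup.center G))
    rw [hj']
    refine (Nat.pow_le_pow_right hp.pos (?_ : j ≤ 1)).trans_eq (pow_one p)
    by_contra! hj2
    obtain rfl : j = 2 := by omega
    have := Subgroup.eq_of_le_of_card_ge
      (inf_le_left : Subgroup.center G ⊓ H ≤ Subgroup.center G) (hj' ▸ hZ.le)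
    exact hH (hle.trans (inf_eq_left.1 this))
  have h1 := card_eq_card_mul_relIndex (le_sup_right : Subgroup.center G ≤ H ⊔ Subgroup.center G)
  have h2 := card_eq_card_mul_relIndex (inf_le_right : Subgroup.center G ⊓ H ≤ H)
  rw [Subgroup.relIndex_sup_right, hZ] at h1
  rw [Subgroup.inf_relIndex_right] at h2
  have h3 := (H ⊔ Subgroup.center G).card_mul_index
  have h4 := H.card_mul_index
  rw [h1, hG] at h3
  rw [h2, hG] at h4
  set r := (Subgroup.center G).relIndex H
  have hp0 := hp.pos
  have hr : r ≤ p ^ 2 := by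
    have : p ^ 4 * r ≤ p ^ 4 * p ^ 2 := by
      calc p ^ 4 * r = p ^ 2 * r * p ^ 2 := by ring
        _ ≤ p ^ 2 * r * (H ⊔ Subgroup.center G).index := by gcongr
        _ = p ^ 4 * p ^ 2 := by rw [h3]; ring
    exact Nat.le_of_mul_le_mul_left this (by positivity)
  have : p ^ 3 * p ^ 3 ≤ p ^ 3 * H.index := by
    calc p ^ 3 * p ^ 3 = Nat.card (Subgroup.center G ⊓ H : Subgroup G) * r * H.index := by
          rw [h4]; ring
      _ ≤ p * p ^ 2 * H.index := by gcongr
      _ = p ^ 3 * H.index := by ring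
  exact Nat.le_of_mul_le_mul_left this (by positivity)

/-! ### Extraspecial groups of order `p ^ 5` -/

theorem mul_pow_of_commutator_le_center {G : Type*} [Group G]
    (hG : commutator G ≤ Subgroup.center G) (x y : G) (n : ℕ) :
    (x * y) ^ n = x ^ n * y ^ n * ⁅y, x⁆ ^ n.choose 2 := by
  have hc : ∀ k : ℕ, ⁅y, x⁆ ^ k ∈ Subgroup.center G := fun k =>
    pow_mem (hG (Subgroup.commutator_mem_commutator (Subgroup.mem_top y) (Subgroup.mem_top x))) k
  induction n with
  | zero => simp
  | succ n ih =>
    have h1 : y ^ n * x = x * y ^ n * ⁅y, x⁆ ^ n := by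
      have h2 : y ^ n * x = ⁅y ^ n, x⁆ * (x * y ^ n) := by
        rw [commutatorElement_def]; group
      rw [h2, commutatorElement_pow_left hG, Subgroup.mem_center_iff.1 (hc n)]
    calc (x * y) ^ (n + 1) = x ^ n * y ^ n * (⁅y, x⁆ ^ n.choose 2 * (x * y)) := by
          rw [pow_succ, ih, mul_assoc]
      _ = x ^ n * (y ^ n * x) * y * ⁅y, x⁆ ^ n.choose 2 := by
          rw [← Subgroup.mem_center_iff.1 (hc _)]; simp only [mul_assoc]
      _ = x ^ (n + 1) * y ^ n * (⁅y, x⁆ ^ n * y) * ⁅y, x⁆ ^ n.choose 2 := by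
          rw [h1, pow_succ]; simp only [mul_assoc]
      _ = x ^ (n + 1) * y ^ (n + 1) * ⁅y, x⁆ ^ (n + 1).choose 2 := by
          rw [← Subgroup.mem_center_iff.1 (hc _), Nat.choose_succ_succ' n 1, Nat.choose_one_right,
            pow_add ⁅y, x⁆, pow_succ y]
          simp only [mul_assoc]

/-- The homomorphism `x ↦ x ^ p` of a group of class at most two into its centre, for an odd prime
`p` annihilating the derived subgroup. -/
def powHomOfClassTwo {G : Type*} [Group G] (hG : commutator G ≤ Subgroup.center G) {p : ℕ}
    (hp : p.Prime) (hp2 : p ≠ 2) (hexp : ∀ z ∈ commutator G, z ^ p = 1) :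
    G →* Subgroup.center G where
  toFun x := ⟨x ^ p, Subgroup.mem_center_iff.2 fun y => by
    rw [← commutatorElement_eq_one_iff_mul_comm, commutatorElement_pow_right hG]
    exact hexp _ (Subgroup.commutator_mem_commutator (Subgroup.mem_top y) (Subgroup.mem_top x))⟩
  map_one' := by simp
  map_mul' x y := by
    obtain ⟨k, hk⟩ := hp.dvd_choose_self two_ne_zero (lt_of_le_of_ne hp.two_le hp2.symm)
    ext
    simp only [Subgroup.coe_mul]
    rw [mul_pow_of_commutator_le_center hG, hk, pow_mul, hexp _ (Subgroup.commutator_mem_commutator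
      (Subgroup.mem_top y) (Subgroup.mem_top x)), one_pow, mul_one]

/-- A cyclic subgroup of prime order is contained in `K` or meets it trivially. -/
theorem zpow_eq_one_of_zpow_mem {p : ℕ} (hp : p.Prime) {G : Type*} [Group G] {x : G}
    (hx : x ^ p = 1) {K : Subgroup G} (hK : x ∉ K) {j : ℤ} (hj : x ^ j ∈ K) : x ^ j = 1 := by
  by_cases hpj : (p : ℤ) ∣ j
  · obtain ⟨k, rfl⟩ := hpj
    rw [zpow_mul, zpow_natCast, hx, one_zpow]
  · obtain ⟨a, b, hab⟩ := (Nat.prime_iff_prime_int.1 hp).coprime_iff_not_dvd.2 hpj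
    refine absurd ?_ hK
    rw [← zpow_one x, ← hab, zpow_add, mul_comm, zpow_mul, mul_comm, zpow_mul, zpow_natCast, hx,
      one_zpow, one_mul]
    exact zpow_mem hj b

/-- In a group of class two every nontrivial normal subgroup meets the centre nontrivially. -/
theorem normalCore_eq_bot_of_inf_center_eq_bot {G : Type*} [Group G]
    (hG : commutator G ≤ Subgroup.center G) {L : Subgroup G} (hL : L ⊓ Subgroup.center G = ⊥) :
    L.normalCore = ⊥ := by
  have key : ∀ k ∈ L.normalCore, k ∈ Subgroup.center G → k = 1 := fun k hk hkc =>
    (Subgroup.mem_bot).1 (hL ▸ ⟨L.normalCore_le hk, hkc⟩)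
  refine (Subgroup.eq_bot_iff_forall _).2 fun k hk => key k hk
    (Subgroup.mem_center_iff.2 fun y => ?_)
  rw [eq_comm, ← commutatorElement_eq_one_iff_mul_comm]
  refine key _ ?_ (hG (Subgroup.commutator_mem_commutator (Subgroup.mem_top k)
    (Subgroup.mem_top y)))
  rw [commutatorElement_def, mul_assoc, mul_assoc]
  refine mul_mem hk ?_
  rw [← mul_assoc]
  exact L.normalCore_normal.conj_mem _ (inv_mem hk) y

/-- The minimal degree of an extraspecial group of order `p ^ 5` is at most `p ^ 3`: the elements of
order dividing `p` form a subgroup of index at most `p`, in which one finds commuting elements `u`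
and `v`, independent modulo the centre, that generate a core-free subgroup of index `p ^ 3`. -/
theorem minFaithfulPermDegree_le_of_card_center_eq_prime {p : ℕ} (hp : p.Prime) (hp2 : p ≠ 2)
    {G : Type*} [Group G] [Finite G] (hcard : Nat.card G = p ^ 5)
    (hZ : Nat.card (Subgroup.center G) = p) (hG : commutator G ≤ Subgroup.center G) :
    minFaithfulPermDegree G ≤ p ^ 3 := by
  have hexp : ∀ z ∈ commutator G, z ^ p = 1 := fun z hz => by
    have := pow_card_eq_one' (x := (⟨z, hG hz⟩ : Subgroup.center G))
    rw [hZ] at this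
    exact congrArg Subtype.val this
  set π := powHomOfClassTwo hG hp hp2 hexp
  have hπ : π.ker.index ≤ p := by
    rw [Subgroup.index_ker]
    exact (Subgroup.card_le_card_group _).trans_eq hZ
  -- A subgroup of order more than `|K|` is not contained in `K`.
  have hbig : ∀ (A : Subgroup G) (a b : ℕ), A.index ≤ p ^ a → a + b < 5 → ∀ K : Subgroup G,
      Nat.card K ≤ p ^ b → ∃ u ∈ A, u ∉ K := by
    intro A a b hA hab K hK
    by_contra! hall
    have h1 := Nat.mul_le_mul ((Subgroup.card_le_of_le (show A ≤ K from hall)).trans hK) hA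
    rw [A.card_mul_index, hcard, ← pow_add, Nat.pow_le_pow_iff_right hp.one_lt] at h1
    omega
  obtain ⟨u, hu, huZ⟩ := hbig π.ker 1 1 (by simpa using hπ) (by norm_num) (Subgroup.center G)
    (by simpa using hZ.le)
  have hup : u ^ p = 1 := congrArg Subtype.val (MonoidHom.mem_ker.1 hu)
  have hu1 : u ≠ 1 := fun h => huZ (h ▸ one_mem _)
  have hcu : Nat.card (Subgroup.zpowers u) = p := by
    rw [Nat.card_zpowers]
    have := Fact.mk hp
    exact orderOf_eq_prime hup hu1
  obtain ⟨v, ⟨hv, hvu⟩, hvK⟩ := hbig (π.ker ⊓ (commutatorHom hG u).ker) 2 2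
    ((Subgroup.index_inf_le ..).trans (by
      rw [pow_two]
      refine Nat.mul_le_mul hπ ?_
      rw [Subgroup.index_ker]
      exact (Subgroup.card_le_card_group _).trans_eq hZ)) (by norm_num)
    (Subgroup.zpowers u ⊔ Subgroup.center G) (by
      have := Set.natCard_mul_le (s := (Subgroup.zpowers u : Set G))
        (t := (Subgroup.center G : Set G))
      rw [← Subgroup.mul_normal] at this
      rw [pow_two]
      exact this.trans_eq (congrArg₂ _ hcu hZ))
  have hvp : v ^ p = 1 := congrArg Subtype.val (MonoidHom.mem_ker.1 hv)
  have huv : Commute u v := commutatorElement_eq_one_iff_commute.1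
    (congrArg Subtype.val (MonoidHom.mem_ker.1 hvu))
  set L := Subgroup.zpowers u ⊔ Subgroup.zpowers v
  have hL : L ⊓ Subgroup.center G = ⊥ := by
    rw [Subgroup.eq_bot_iff_forall]
    rintro x ⟨hx, hxZ⟩
    obtain ⟨i, j, rfl⟩ : ∃ i j : ℤ, u ^ i * v ^ j = x := by
      have hnorm : Subgroup.zpowers u ≤ Subgroup.normalizer (Subgroup.zpowers v : Set G) := by
        refine Subgroup.zpowers_le.2 (Subgroup.centralizer_le_normalizer _ ?_)
        refine Subgroup.mem_centralizer_iff.2 ?_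
        rintro _ ⟨j, rfl⟩
        exact (huv.zpow_right j).eq.symm
      change x ∈ (L : Set G) at hx
      rw [Subgroup.coe_mul_of_left_le_normalizer_right _ _ hnorm] at hx
      obtain ⟨_, ⟨i, rfl⟩, _, ⟨j, rfl⟩, rfl⟩ := hx
      exact ⟨i, j, rfl⟩
    have h1 : v ^ j = 1 := by
      refine zpow_eq_one_of_zpow_mem hp hvp hvK ?_
      rw [← inv_mul_cancel_left (u ^ i) (v ^ j)]
      exact mul_mem (inv_mem (Subgroup.mem_sup_left ⟨i, rfl⟩)) (Subgroup.mem_sup_right hxZ)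
    rw [h1, mul_one] at hxZ ⊢
    exact zpow_eq_one_of_zpow_mem hp hup huZ hxZ
  refine (minFaithfulPermDegree_le_index L (normalCore_eq_bot_of_inf_center_eq_bot hG hL)).trans ?_
  obtain ⟨j, -, hj⟩ := (Nat.dvd_prime_pow hp).1 (hcard ▸ L.card_subgroup_dvd_card)
  have hj2 : 2 ≤ j := by
    by_contra! hj2
    have h1 : Nat.card L ≤ Nat.card (Subgroup.zpowers u) := by
      rw [hj, hcu]
      exact (Nat.pow_le_pow_right hp.pos (show j ≤ 1 by omega)).trans_eq (pow_one p)
    have h2 := Subgroup.eq_of_le_of_card_ge (le_sup_left : Subgroup.zpowers u ≤ L) h1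
    refine hvK (Subgroup.mem_sup_left (h2 ▸ ?_))
    exact Subgroup.mem_sup_right (Subgroup.mem_zpowers v)
  have h1 := L.card_mul_index
  rw [hj, hcard] at h1
  refine Nat.le_of_mul_le_mul_left (c := p ^ 2) ?_ (pow_pos hp.pos 2)
  calc p ^ 2 * L.index ≤ p ^ j * L.index := by gcongr; exact hp.one_le
    _ = p ^ 2 * p ^ 3 := by rw [h1]; ring

/-! ### Cyclic groups and rank -/

theorem eq_of_card_eq_prime_of_isCyclic {p : ℕ} (hp : p.Prime) {G : Type*} [Group G] [Finite G]
    [IsCyclic G] {A B : Subgroup G} (hA : Nat.card A = p) (hB : Nat.card B = p) : A = B := by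
  classical
  have := Fintype.ofFinite G
  have key : ∀ C : Subgroup G, Nat.card C = p →
      (C : Set G) = (Finset.univ.filter fun a : G => a ^ p = 1 : Finset G) := by
    intro C hC
    refine Set.eq_of_subset_of_ncard_le (fun c hc => ?_) ?_
    · have := pow_card_eq_one' (x := (⟨c, hc⟩ : C))
      rw [hC] at this
      simpa using congrArg Subtype.val this
    · rw [Set.ncard_coe_finset]
      exact (IsCyclic.card_pow_eq_one_le hp.pos).trans_eq hC.symm
  exact SetLike.coe_injective ((key A hA).trans (key B hB).symm)

theorem isCyclic_of_rank_le_one {G : Type*} [Group G] [Group.FG G] (h : Group.rank G ≤ 1) :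
    IsCyclic G := by
  obtain ⟨S, hS, hS'⟩ := Group.rank_spec G
  rw [← hS, Finset.card_le_one_iff_subset_singleton] at h
  obtain ⟨x, hx⟩ := h
  refine isCyclic_iff_exists_zpowers_eq_top.2 ⟨x, top_le_iff.1 ?_⟩
  rw [← hS', Subgroup.closure_le]
  intro y hy
  obtain rfl := Finset.mem_singleton.1 (hx hy)
  exact Subgroup.mem_zpowers y

theorem rank_le_one_of_isCyclic {G : Type*} [Group G] [Group.FG G] [IsCyclic G] :
    Group.rank G ≤ 1 := by
  obtain ⟨g, hg⟩ := isCyclic_iff_exists_zpowers_eq_top.1 ‹IsCyclic G›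
  refine (Group.rank_le (S := {g}) ?_).trans_eq (Finset.card_singleton g)
  rw [Finset.coe_singleton, ← Subgroup.zpowers_eq_closure, hg]

/-! ### Quotients by normal subgroups -/

/-- Some `g ∉ Z` has `g ^ p ∈ Z`, so `⁅g, y⁆ ^ p = ⁅g ^ p, y⁆ = 1`; since `[g, G] = G'`, the derived
subgroup has exponent `p`, and therefore all `p`-th powers are central. -/
theorem pow_prime_mem_center {p : ℕ} (hp : p.Prime) {G : Type*} [Group G]
    [Finite G] (hG : Nat.card G = p ^ 6) (hZ : Nat.card (Subgroup.center G) = p ^ 2)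
    (hle : commutator G ≤ Subgroup.center G)
    (hcomm : ∀ g ∉ Subgroup.center G, ∀ z ∈ commutator G, ∃ y, ⁅g, y⁆ = z) (x : G) :
    x ^ p ∈ Subgroup.center G := by
  have := Fact.mk hp
  have hi : Nat.card (G ⧸ Subgroup.center G) = p ^ 4 := by
    have := (Subgroup.center G).card_mul_index
    rw [hZ, hG] at this
    exact Nat.eq_of_mul_eq_mul_left (pow_pos hp.pos 2) (this.trans (by ring))
  obtain ⟨q, hq⟩ := exists_prime_orderOf_dvd_card' (G := G ⧸ Subgroup.center G) p
    (hi ▸ dvd_pow_self p (by norm_num))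
  obtain ⟨g, rfl⟩ := QuotientGroup.mk_surjective q
  have hg : g ∉ Subgroup.center G := fun h => by
    rw [(QuotientGroup.eq_one_iff g).2 h, orderOf_one] at hq
    exact hp.one_lt.ne hq
  have hgp : g ^ p ∈ Subgroup.center G := by
    rw [← QuotientGroup.eq_one_iff, QuotientGroup.mk_pow, ← hq, pow_orderOf_eq_one]
  have hexp : ∀ z ∈ commutator G, z ^ p = 1 := by
    intro z hz
    obtain ⟨y, rfl⟩ := hcomm g hg z hz
    rw [← commutatorElement_pow_left hle, commutatorElement_eq_one_iff_mul_comm,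
      Subgroup.mem_center_iff.1 hgp]
  refine Subgroup.mem_center_iff.2 fun y => ?_
  rw [← commutatorElement_eq_one_iff_mul_comm, commutatorElement_pow_right hle]
  exact hexp _ (Subgroup.commutator_mem_commutator (Subgroup.mem_top y) (Subgroup.mem_top x))

/-- The `p`-th power of `x` is central, and `G'` has index at most `p` in the centre. -/
theorem pow_sq_mem_commutator {p : ℕ} (hp : p.Prime) {G : Type*} [Group G]
    [Finite G] (hG : Nat.card G = p ^ 6) (hZ : Nat.card (Subgroup.center G) = p ^ 2)
    (hle : commutator G ≤ Subgroup.center G) (hne : commutator G ≠ ⊥)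
    (hcomm : ∀ g ∉ Subgroup.center G, ∀ z ∈ commutator G, ∃ y, ⁅g, y⁆ = z) (x : G) :
    x ^ p ^ 2 ∈ commutator G := by
  have hx := pow_prime_mem_center hp hG hZ hle hcomm x
  have hr : (commutator G).relIndex (Subgroup.center G) ∣ p := by
    have h1 := card_eq_card_mul_relIndex hle
    obtain ⟨j, hj, hj'⟩ := (Nat.dvd_prime_pow hp).1 (hZ ▸ Subgroup.card_dvd_of_le hle)
    have hj0 : j ≠ 0 := by
      rintro rfl
      exact hne (Subgroup.card_eq_one.1 (hj'.trans (pow_zero p)))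
    obtain ⟨i, rfl⟩ := Nat.exists_eq_succ_of_ne_zero hj0
    refine Nat.dvd_of_mul_dvd_mul_left hp.pos ?_
    rw [← pow_two, ← hZ, h1, hj', pow_succ']
    exact Nat.mul_dvd_mul_right (Dvd.intro _ rfl) _
  have h2 := Subgroup.pow_index_mem ((commutator G).subgroupOf (Subgroup.center G)) ⟨x ^ p, hx⟩
  obtain ⟨k, hk⟩ := hr
  have h3 := pow_mem h2 k
  rw [← pow_mul, ← Subgroup.relIndex, ← hk, Subgroup.mem_subgroupOf] at h3
  rwa [pow_two, pow_mul]

theorem minFaithfulPermDegree_quotient_le_of_commutator_le {p : ℕ} (hp : p.Prime) (hp5 : 5 ≤ p)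
    {G : Type*} [Group G]
    [Finite G] (hG : Nat.card G = p ^ 6) (hZ : Nat.card (Subgroup.center G) = p ^ 2)
    (hle : commutator G ≤ Subgroup.center G) (hne : commutator G ≠ ⊥)
    (hcomm : ∀ g ∉ Subgroup.center G, ∀ z ∈ commutator G, ∃ y, ⁅g, y⁆ = z)
    (N : Subgroup G) [N.Normal] (hN : commutator G ≤ N) :
    minFaithfulPermDegree (G ⧸ N) ≤ p ^ 3 := by
  have := Subgroup.Normal.quotient_commutative_iff_commutator_le.2 hN
  let : CommGroup (G ⧸ N) := { (inferInstance : Group (G ⧸ N)) with mul_comm := this.is_comm.comm }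
  refine (minFaithfulPermDegree_le_of_comm hp (k := 5) ?_ ?_).trans ?_
  · obtain ⟨j, hj, hj'⟩ := (Nat.dvd_prime_pow hp).1 (hG ▸ N.card_subgroup_dvd_card)
    have hj0 : j ≠ 0 := by
      rintro rfl
      exact hne (le_bot_iff.1 (hN.trans_eq (Subgroup.card_eq_one.1 (hj'.trans (pow_zero p)))))
    obtain ⟨i, rfl⟩ := Nat.exists_eq_succ_of_ne_zero hj0
    have h1 := N.card_mul_index
    refine Nat.dvd_of_mul_dvd_mul_left hp.pos ?_
    rw [← pow_succ', ← hG, ← h1, hj', pow_succ']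
    exact Nat.mul_dvd_mul_right (Dvd.intro _ rfl) _
  · intro a
    obtain ⟨x, rfl⟩ := QuotientGroup.mk_surjective a
    exact (QuotientGroup.eq_one_iff _).2 (hN (pow_sq_mem_commutator hp hG hZ hle hne hcomm x))
  · rw [pow_succ' p 2]
    gcongr

/-- The quotient by `N` is extraspecial: `[g, G] = G' = Z` is not contained in `N` for `g ∉ Z`, so
the preimage of the centre of `G ⧸ N` is `Z`. -/
theorem minFaithfulPermDegree_quotient_le_of_card_eq {p : ℕ} (hp : p.Prime) (hp2 : p ≠ 2)
    {G : Type*} [Group G]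
    [Finite G] (hG : Nat.card G = p ^ 6) (hZ : Nat.card (Subgroup.center G) = p ^ 2)
    (hle : commutator G = Subgroup.center G)
    (hcomm : ∀ g ∉ Subgroup.center G, ∀ z ∈ commutator G, ∃ y, ⁅g, y⁆ = z)
    (N : Subgroup G) [N.Normal] (hN : Nat.card N = p) :
    minFaithfulPermDegree (G ⧸ N) ≤ p ^ 3 := by
  have hmk : Function.Surjective (QuotientGroup.mk' N) := QuotientGroup.mk'_surjective N
  have hcomap : (Subgroup.center (G ⧸ N)).comap (QuotientGroup.mk' N) = Subgroup.center G := by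
    refine le_antisymm (fun g hg => ?_) fun g hg => ?_
    · by_contra hgZ
      have hCN : commutator G ≤ N := fun z hz => by
        obtain ⟨y, rfl⟩ := hcomm g hgZ z hz
        rw [← QuotientGroup.eq_one_iff]
        change QuotientGroup.mk' N _ = 1
        rw [map_commutatorElement, commutatorElement_eq_one_iff_mul_comm,
          Subgroup.mem_center_iff.1 (Subgroup.mem_comap.1 hg)]
      have := Subgroup.card_le_of_le (hle ▸ hCN)
      rw [hN, hZ] at this
      nlinarith [hp.one_lt]
    · refine Subgroup.mem_center_iff.2 fun y => ?_
      obtain ⟨y, rfl⟩ := hmk y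
      rw [← map_mul, ← map_mul, Subgroup.mem_center_iff.1 hg]
  have hcard : Nat.card (G ⧸ N) = p ^ 5 := by
    have := N.card_mul_index
    rw [hN, hG] at this
    exact Nat.eq_of_mul_eq_mul_left hp.pos (this.trans (by ring))
  refine minFaithfulPermDegree_le_of_card_center_eq_prime hp hp2 hcard ?_ ?_
  · have h1 := (Subgroup.center G).card_mul_index
    have h2 := (Subgroup.center (G ⧸ N)).card_mul_index
    rw [← hcomap, Subgroup.index_comap_of_surjective _ hmk, hcomap, hZ, hG] at h1
    rw [hcard] at h2
    have h3 := Nat.eq_of_mul_eq_mul_left (pow_pos hp.pos 2) (h1.trans (by ring : _ = p ^ 2 * p ^ 4))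
    rw [h3] at h2
    exact Nat.eq_of_mul_eq_mul_right (pow_pos hp.pos 4) (h2.trans (by ring))
  · rw [commutator_def, Subgroup.commutator_le]
    intro x _ y _
    obtain ⟨x, rfl⟩ := hmk x
    obtain ⟨y, rfl⟩ := hmk y
    rw [← map_commutatorElement, ← Subgroup.mem_comap, hcomap, ← hle]
    exact Subgroup.commutator_mem_commutator (Subgroup.mem_top x) (Subgroup.mem_top y)

/-! ### Criterion for not being exceptional -/

/-- The common core of both parts. The hypothesis `hcyc` is what the equality of ranks contributes;
it is vacuous when `G'` is the whole centre. -/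
theorem not_isExceptionalGroup {p : ℕ} (hp : p.Prime) (hp5 : 5 ≤ p) {G : Type*} [Group G]
    [Finite G] (hG : Nat.card G = p ^ 6) (hZ : Nat.card (Subgroup.center G) = p ^ 2)
    (hle : commutator G ≤ Subgroup.center G)
    (hcomm : ∀ g ∉ Subgroup.center G, ∀ z ∈ commutator G, ∃ y, ⁅g, y⁆ = z)
    (hcyc : Nat.card (commutator G) = p → IsCyclic (Subgroup.center G)) :
    ¬ IsExceptionalGroup G := by
  have hne : commutator G ≠ ⊥ := by
    intro h
    have h1 := (commutator_eq_bot_iff_center_eq_top G).1 h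
    rw [h1, Subgroup.card_top, hG] at hZ
    exact absurd (Nat.pow_right_injective hp.two_le hZ) (by norm_num)
  rintro ⟨N, hN, hlt⟩
  by_cases hNbot : N = ⊥
  · subst hNbot
    exact hlt.not_ge (minFaithfulPermDegree_le_of_injective
      (QuotientGroup.quotientBot (G := G)).toMonoidHom (MulEquiv.injective _))
  have hlow := le_minFaithfulPermDegree (commutator G) hne (p ^ 3)
    (pow_three_le_index hp hG hZ hle hcomm)
  refine hlt.not_ge (le_trans ?_ hlow)
  by_cases hCN : commutator G ≤ N
  · exact minFaithfulPermDegree_quotient_le_of_commutator_le hp hp5 hG hZ hle hne hcomm N hCN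
  have hNZ : N ≤ Subgroup.center G := by
    intro g hg
    by_contra hgZ
    refine hCN fun z hz => ?_
    obtain ⟨y, rfl⟩ := hcomm g hgZ z hz
    rw [commutatorElement_def, mul_assoc, mul_assoc]
    refine mul_mem hg ?_
    rw [← mul_assoc]
    exact hN.conj_mem _ (inv_mem hg) y
  -- A nontrivial proper subgroup of the centre has order `p`.
  have hsub : ∀ A : Subgroup G, A ≤ Subgroup.center G → A ≠ ⊥ → A ≠ Subgroup.center G →
      Nat.card A = p := by
    intro A hAZ hA hA'
    obtain ⟨j, hj, hj'⟩ := (Nat.dvd_prime_pow hp).1 (hZ ▸ Subgroup.card_dvd_of_le hAZ)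
    interval_cases j
    · exact absurd (Subgroup.card_eq_one.1 (hj'.trans (pow_zero p))) hA
    · exact hj'.trans (pow_one p)
    · exact absurd (Subgroup.eq_of_le_of_card_ge hAZ (hZ.trans hj'.symm).le) hA'
  have hNp : Nat.card N = p := hsub N hNZ hNbot fun h => hCN (h ▸ hle)
  by_cases hCZ : commutator G = Subgroup.center G
  · exact minFaithfulPermDegree_quotient_le_of_card_eq hp (by omega) hG hZ hCZ hcomm N hNp
  · have hCp := hsub _ hle hne hCZ
    have := hcyc hCp
    have h1 := eq_of_card_eq_prime_of_isCyclic hp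
      (A := (commutator G).subgroupOf (Subgroup.center G)) (B := N.subgroupOf (Subgroup.center G))
      ((Nat.card_congr (Subgroup.subgroupOfEquivOfLe hle).toEquiv).trans hCp)
      ((Nat.card_congr (Subgroup.subgroupOfEquivOfLe hNZ).toEquiv).trans hNp)
    rw [Subgroup.subgroupOf_inj, inf_of_le_left hle, inf_of_le_left hNZ] at h1
    exact absurd h1.le hCN

theorem not_isExceptionalGroup_of_isVZGroup {p : ℕ} (hp : p.Prime) (hp5 : 5 ≤ p) {G : Type*}
    [Group G] [Finite G] (hG : Nat.card G = p ^ 6) (hVZ : IsVZGroup G)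
    (hrank : Group.rank (Subgroup.center G) = Group.rank (commutator G))
    (hZ : Nat.card (Subgroup.center G) = p ^ 2) : ¬ IsExceptionalGroup G := by
  have hpG : IsPGroup p G := IsPGroup.of_card hG
  refine not_isExceptionalGroup hp hp5 hG hZ (hVZ.commutator_le_center hp (by omega) hpG)
    (fun g hg z hz => hVZ.exists_commutatorElement_eq hp (by omega) hpG hg hz) fun hc => ?_
  have := Fact.mk hp
  have := isCyclic_of_prime_card hc
  exact isCyclic_of_rank_le_one (hrank.trans_le rank_le_one_of_isCyclic)

/-! ### The least primitive root -/

theorem isPrimitiveRoot_leastPrimitiveRoot {p : ℕ} (hp : p.Prime) :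
    IsPrimitiveRoot (leastPrimitiveRoot p : ZMod p) (p - 1) := by
  have := Fact.mk hp
  have hne : {w : ℕ | 0 < w ∧ IsPrimitiveRoot (w : ZMod p) (p - 1)}.Nonempty := by
    obtain ⟨u, hu⟩ := IsCyclic.exists_ofOrder_eq_natCard (α := (ZMod p)ˣ)
    rw [Nat.card_eq_fintype_card, ZMod.card_units] at hu
    refine ⟨(u : ZMod p).val, ZMod.val_pos.2 u.ne_zero, ?_⟩
    rw [ZMod.natCast_zmod_val, ← hu, IsPrimitiveRoot.coe_units_iff]
    exact IsPrimitiveRoot.orderOf u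
  exact (Nat.sInf_mem hne).2

theorem not_isSquare_leastPrimitiveRoot {p : ℕ} (hp : p.Prime) (hp3 : 3 ≤ p) :
    ¬ IsSquare (leastPrimitiveRoot p : ZMod p) := by
  have := Fact.mk hp
  have hω := isPrimitiveRoot_leastPrimitiveRoot hp
  rintro ⟨a, ha⟩
  have ha0 : a ≠ 0 := by
    rintro rfl
    exact hω.ne_zero (by omega) (by simpa using ha)
  -- A square `ω = a ^ 2` satisfies `ω ^ ((p - 1) / 2) = 1`.
  obtain ⟨k, hk⟩ := hp.even_sub_one (by omega)
  refine hω.pow_ne_one_of_pos_of_lt (l := k) (by omega) (by omega) ?_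
  rw [ha, ← pow_two, ← pow_mul, two_mul, ← hk, ZMod.pow_card_sub_one_eq_one ha0]

/-! ### A model of `Φ₁₅(1⁶)` -/

/-- The group on `R ^ 6` that models `Φ₁₅(1⁶)` for `R = ZMod p`: a central extension of the additive
group `R ^ 4`, with coordinates `a, b, c, d`, by `R ^ 2`, with coordinates `s, t`, given by the
bilinear cocycles `a b' + c d'` and `a c' + ω b d'`. -/
@[ext]
structure Phi15Model {R : Type*} (ω : R) where
  a : R
  b : R
  c : R
  d : R
  s : R
  t : R

namespace Phi15Model

/-- The underlying set of the model is `R ^ 6`. -/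
def equivProd {R : Type*} (ω : R) : Phi15Model ω ≃ R × R × R × R × R × R where
  toFun x := (x.a, x.b, x.c, x.d, x.s, x.t)
  invFun x := ⟨x.1, x.2.1, x.2.2.1, x.2.2.2.1, x.2.2.2.2.1, x.2.2.2.2.2⟩

theorem card_eq {R : Type*} (ω : R) : Nat.card (Phi15Model ω) = Nat.card R ^ 6 := by
  rw [Nat.card_congr (equivProd ω)]
  simp only [Nat.card_prod]
  ring

variable {R : Type*} [CommRing R] {ω : R}

instance : Mul (Phi15Model ω) :=
  ⟨fun x y => ⟨x.a + y.a, x.b + y.b, x.c + y.c, x.d + y.d,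
    x.s + y.s + x.a * y.b + x.c * y.d, x.t + y.t + x.a * y.c + ω * x.b * y.d⟩⟩

instance : One (Phi15Model ω) := ⟨⟨0, 0, 0, 0, 0, 0⟩⟩

instance : Inv (Phi15Model ω) :=
  ⟨fun x => ⟨-x.a, -x.b, -x.c, -x.d, -x.s + x.a * x.b + x.c * x.d,
    -x.t + x.a * x.c + ω * x.b * x.d⟩⟩

theorem mul_def (x y : Phi15Model ω) : x * y =
    ⟨x.a + y.a, x.b + y.b, x.c + y.c, x.d + y.d,
    x.s + y.s + x.a * y.b + x.c * y.d, x.t + y.t + x.a * y.c + ω * x.b * y.d⟩ := rfl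

theorem one_def : (1 : Phi15Model ω) = ⟨0, 0, 0, 0, 0, 0⟩ := rfl

theorem inv_def (x : Phi15Model ω) : x⁻¹ =
    ⟨-x.a, -x.b, -x.c, -x.d, -x.s + x.a * x.b + x.c * x.d,
    -x.t + x.a * x.c + ω * x.b * x.d⟩ := rfl

instance : Group (Phi15Model ω) :=
  Group.ofLeftAxioms
    (fun x y z => by
      simp only [mul_def, mk.injEq]
      refine ⟨?_, ?_, ?_, ?_, ?_, ?_⟩ <;> ring)
    (fun x => by simp [mul_def, one_def])
    (fun x => by
      simp only [mul_def, one_def, inv_def, mk.injEq]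
      refine ⟨?_, ?_, ?_, ?_, ?_, ?_⟩ <;> ring)

theorem commutatorElement_eq (x y : Phi15Model ω) : ⁅x, y⁆ =
    ⟨0, 0, 0, 0, x.a * y.b - x.b * y.a + (x.c * y.d - x.d * y.c),
      x.a * y.c - x.c * y.a + ω * (x.b * y.d - x.d * y.b)⟩ := by
  simp only [commutatorElement_def, mul_def, inv_def, mk.injEq]
  refine ⟨?_, ?_, ?_, ?_, ?_, ?_⟩ <;> ring

/-- On elements where the cocycle of `(x, x)` vanishes, powers are computed coordinatewise. -/
theorem pow_eq (x : Phi15Model ω) (h1 : x.a * x.b + x.c * x.d = 0)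
    (h2 : x.a * x.c + ω * x.b * x.d = 0) (n : ℕ) :
    x ^ n = ⟨n * x.a, n * x.b, n * x.c, n * x.d, n * x.s, n * x.t⟩ := by
  induction n with
  | zero => simp [one_def]
  | succ n ih =>
    rw [pow_succ, ih]
    simp only [mul_def, mk.injEq]
    push_cast
    refine ⟨by ring, by ring, by ring, by ring, ?_, ?_⟩
    · linear_combination (n : R) * h1
    · linear_combination (n : R) * h2

theorem zpow_eq (x : Phi15Model ω) (h1 : x.a * x.b + x.c * x.d = 0)
    (h2 : x.a * x.c + ω * x.b * x.d = 0) (n : ℤ) :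
    x ^ n = ⟨n * x.a, n * x.b, n * x.c, n * x.d, n * x.s, n * x.t⟩ := by
  obtain ⟨n, rfl | rfl⟩ := n.eq_nat_or_neg
  · rw [zpow_natCast, pow_eq x h1 h2]
    simp
  · rw [zpow_neg, zpow_natCast, pow_eq x h1 h2, inv_def]
    simp only [mk.injEq]
    push_cast
    refine ⟨by ring, by ring, by ring, by ring, ?_, ?_⟩
    · linear_combination (n : R) ^ 2 * h1
    · linear_combination (n : R) ^ 2 * h2

end Phi15Model

namespace Phi15Model

variable {F : Type*} [Field F] {ω : F}

/-- The binary form `x² - ω y²` is anisotropic. -/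
theorem sq_sub_mul_sq_ne_zero (hω : ¬ IsSquare ω) {x y : F} (h : x ≠ 0 ∨ y ≠ 0) :
    x ^ 2 - ω * y ^ 2 ≠ 0 := by
  intro h0
  by_cases hy : y = 0
  · subst hy
    simp_all
  · refine hω ⟨x / y, ?_⟩
    field_simp
    linear_combination -h0

/-- The equations for `y` are linear. When `(a, d) ≠ 0` they are solved in the second and third
coordinate of `y`, with determinant `a² - ω d²`; otherwise `(c, b) ≠ 0` and they are solved in the
first and fourth, with determinant `c² - ω b²`. -/
theorem exists_commutatorElement_eq (hω : ¬ IsSquare ω) (x : Phi15Model ω)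
    (hx : ¬ (x.a = 0 ∧ x.b = 0 ∧ x.c = 0 ∧ x.d = 0)) (s t : F) :
    ∃ y, ⁅x, y⁆ = (⟨0, 0, 0, 0, s, t⟩ : Phi15Model ω) := by
  by_cases h : x.a ≠ 0 ∨ x.d ≠ 0
  · obtain ⟨e, he⟩ := (isUnit_iff_ne_zero.2 (sq_sub_mul_sq_ne_zero hω h)).exists_right_inv
    refine ⟨(⟨0, e * (x.a * s + x.d * t), e * (x.a * t + ω * x.d * s), 0, 0, 0⟩ :
      Phi15Model ω), ?_⟩
    rw [commutatorElement_eq, mk.injEq]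
    exact ⟨rfl, rfl, rfl, rfl, by linear_combination s * he, by linear_combination t * he⟩
  · have h' : x.c ≠ 0 ∨ x.b ≠ 0 := by tauto
    obtain ⟨e, he⟩ := (isUnit_iff_ne_zero.2 (sq_sub_mul_sq_ne_zero hω h')).exists_right_inv
    refine ⟨(⟨e * (ω * x.b * s - x.c * t), 0, 0, e * (x.c * s - x.b * t), 0, 0⟩ :
      Phi15Model ω), ?_⟩
    rw [commutatorElement_eq, mk.injEq]
    exact ⟨rfl, rfl, rfl, rfl, by linear_combination s * he, by linear_combination t * he⟩

theorem mem_center_iff (hω : ¬ IsSquare ω) {x : Phi15Model ω} :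
    x ∈ Subgroup.center (Phi15Model ω) ↔ x.a = 0 ∧ x.b = 0 ∧ x.c = 0 ∧ x.d = 0 := by
  constructor
  · intro hx
    by_contra h
    obtain ⟨y, hy⟩ := exists_commutatorElement_eq hω x h 1 1
    rw [commutatorElement_eq_one_iff_mul_comm.2 (Subgroup.mem_center_iff.1 hx y).symm,
      one_def] at hy
    simp at hy
  · rintro ⟨h1, h2, h3, h4⟩
    refine Subgroup.mem_center_iff.2 fun y => ?_
    rw [eq_comm, ← commutatorElement_eq_one_iff_mul_comm, commutatorElement_eq, h1, h2, h3, h4,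
      one_def]
    simp

theorem commutator_eq_center (hω : ¬ IsSquare ω) :
    commutator (Phi15Model ω) = Subgroup.center (Phi15Model ω) := by
  refine le_antisymm ?_ fun z hz => ?_
  · rw [commutator_def, Subgroup.commutator_le]
    intro x _ y _
    rw [mem_center_iff hω, commutatorElement_eq]
    simp
  · obtain ⟨h1, h2, h3, h4⟩ := (mem_center_iff hω).1 hz
    obtain ⟨y, hy⟩ := exists_commutatorElement_eq hω ⟨1, 0, 0, 0, 0, 0⟩ (by simp) z.s z.t
    rw [show z = ⟨0, 0, 0, 0, z.s, z.t⟩ by ext <;> simp [*], ← hy]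
    exact Subgroup.commutator_mem_commutator (Subgroup.mem_top _) (Subgroup.mem_top _)

theorem card_center (hω : ¬ IsSquare ω) :
    Nat.card (Subgroup.center (Phi15Model ω)) = Nat.card F ^ 2 := by
  let e : Subgroup.center (Phi15Model ω) ≃ F × F :=
    { toFun := fun x => (x.1.s, x.1.t)
      invFun := fun x => ⟨⟨0, 0, 0, 0, x.1, x.2⟩, (mem_center_iff hω).2 (by simp)⟩
      left_inv := fun ⟨x, hx⟩ => by
        obtain ⟨h1, h2, h3, h4⟩ := (mem_center_iff hω).1 hx
        ext <;> simp [*]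
      right_inv := fun x => rfl }
  rw [Nat.card_congr e, Nat.card_prod, pow_two]

end Phi15Model

/-! ### The presentation of `Φ₁₅(1⁶)` -/

namespace Phi15

variable {p : ℕ}

/-- The generator of the model corresponding to a generator of `Φ₁₅(1⁶)`. -/
def modelGen {R : Type*} [CommRing R] (ω : R) : Fin 4 ⊕ Fin 2 → Phi15Model ω :=
  Sum.elim
    ![⟨1, 0, 0, 0, 0, 0⟩, ⟨0, 1, 0, 0, 0, 0⟩, ⟨0, 0, 1, 0, 0, 0⟩, ⟨0, 0, 0, 1, 0, 0⟩]
    ![⟨0, 0, 0, 0, 1, 0⟩, ⟨0, 0, 0, 0, 0, 1⟩]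

theorem modelGen_zpow {R : Type*} [CommRing R] (ω : R) (i : Fin 4 ⊕ Fin 2) (n : ℤ) :
    modelGen ω i ^ n = ⟨n * (modelGen ω i).a, n * (modelGen ω i).b, n * (modelGen ω i).c,
      n * (modelGen ω i).d, n * (modelGen ω i).s, n * (modelGen ω i).t⟩ := by
  refine Phi15Model.zpow_eq _ ?_ ?_ n <;>
  · rcases i with i | i <;> fin_cases i <;> simp [modelGen]

theorem modelGen_pow_prime (ω : ZMod p) (i : Fin 4 ⊕ Fin 2) : modelGen ω i ^ p = 1 := by
  rw [← zpow_natCast, modelGen_zpow, Phi15Model.one_def]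
  simp

theorem lift_modelGen_eq_one (p : ℕ) : ∀ r ∈ relators p,
    FreeGroup.lift (modelGen (leastPrimitiveRoot p : ZMod p)) r = 1 := by
  rintro r (((hr | ⟨i, j, rfl⟩) | ⟨i, rfl⟩) | ⟨j, rfl⟩)
  -- The relator with exponent `ω` is separated out, as it needs the power formula.
  · have h4 : FreeGroup.lift (modelGen (leastPrimitiveRoot p : ZMod p))
        (⁅α 1, α 3⁆ * (β 1 ^ leastPrimitiveRoot p)⁻¹) = 1 := by
      simp only [map_mul, map_commutatorElement, map_inv, map_pow, α, β, FreeGroup.lift_apply_of]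
      rw [mul_inv_eq_one, ← zpow_natCast, modelGen_zpow, Phi15Model.commutatorElement_eq]
      simp [modelGen]
    rcases hr with rfl | rfl | rfl | rfl | rfl | rfl | rfl
    on_goal 4 => exact h4
    all_goals
      simp only [map_mul, map_commutatorElement, map_inv, α, β, FreeGroup.lift_apply_of,
        mul_inv_eq_one, Phi15Model.commutatorElement_eq]
      simp [modelGen, Phi15Model.one_def]
  · simp only [map_commutatorElement, α, β, FreeGroup.lift_apply_of,
      Phi15Model.commutatorElement_eq]
    fin_cases j <;> simp [modelGen, Phi15Model.one_def]
  · simp only [map_pow, α, FreeGroup.lift_apply_of, modelGen_pow_prime]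
  · simp only [map_pow, β, FreeGroup.lift_apply_of, modelGen_pow_prime]

/-- The homomorphism from `Φ₁₅(1⁶)` to its model sending generators to the coordinate elements. -/
noncomputable def toModel (p : ℕ) : StemGroup p →* Phi15Model (leastPrimitiveRoot p : ZMod p) :=
  PresentedGroup.toGroup (lift_modelGen_eq_one p)

/-- The images of the generators `α i` in `Φ₁₅(1⁶)`. -/
def A (p : ℕ) (i : Fin 4) : StemGroup p := PresentedGroup.of (Sum.inl i)

/-- The images of the generators `β j` in `Φ₁₅(1⁶)`. -/
def B (p : ℕ) (i : Fin 2) : StemGroup p := PresentedGroup.of (Sum.inr i)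

theorem A_pow (i : Fin 4) : A p i ^ p = 1 :=
  PresentedGroup.one_of_mem (rels := relators p) (x := α i ^ p) (Or.inl (Or.inr ⟨i, rfl⟩))

theorem B_pow (i : Fin 2) : B p i ^ p = 1 :=
  PresentedGroup.one_of_mem (rels := relators p) (x := β i ^ p) (Or.inr ⟨i, rfl⟩)

theorem commutatorElement_A_B (i : Fin 4) (j : Fin 2) : ⁅A p i, B p j⁆ = 1 :=
  PresentedGroup.one_of_mem (rels := relators p) (x := ⁅α i, β j⁆)
    (Or.inl (Or.inl (Or.inr ⟨i, j, rfl⟩)))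

theorem commutatorElement_B_B : ⁅B p 0, B p 1⁆ = 1 :=
  PresentedGroup.one_of_mem (rels := relators p) (x := ⁅β 0, β 1⁆)
    (Or.inl (Or.inl (Or.inl (by simp))))

theorem B_mem_center (j : Fin 2) : B p j ∈ Subgroup.center (StemGroup p) := by
  refine Subgroup.mem_center_iff.2 fun x => ?_
  have : x ∈ Subgroup.centralizer {B p j} := by
    refine PresentedGroup.generated_by _ _ (fun k => ?_) x
    rw [Subgroup.mem_centralizer_singleton_iff]
    rcases k with i | i
    · exact (commutatorElement_eq_one_iff_mul_comm.1 (commutatorElement_A_B i j))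
    · have h := commutatorElement_eq_one_iff_mul_comm.1 (commutatorElement_B_B (p := p))
      fin_cases i <;> fin_cases j
      · rfl
      · exact h
      · exact h.symm
      · rfl
  exact Subgroup.mem_centralizer_singleton_iff.1 this

/-- The central subgroup generated by the images of `β₁` and `β₂`. -/
def subgroupB (p : ℕ) : Subgroup (StemGroup p) :=
  Subgroup.zpowers (B p 0) ⊔ Subgroup.zpowers (B p 1)

theorem B_mem (j : Fin 2) : B p j ∈ subgroupB p := by
  fin_cases j
  · exact Subgroup.mem_sup_left (Subgroup.mem_zpowers _)
  · exact Subgroup.mem_sup_right (Subgroup.mem_zpowers _)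

theorem subgroupB_le_center : subgroupB p ≤ Subgroup.center (StemGroup p) :=
  sup_le (Subgroup.zpowers_le.2 (B_mem_center 0)) (Subgroup.zpowers_le.2 (B_mem_center 1))

instance : (subgroupB p).Normal where
  conj_mem b hb g := by
    rwa [Subgroup.mem_center_iff.1 (subgroupB_le_center hb), mul_inv_cancel_right]

theorem exists_zpow_of_mem_subgroupB {x : StemGroup p} (hx : x ∈ subgroupB p) :
    ∃ s t : ℤ, x = B p 0 ^ s * B p 1 ^ t := by
  have : (Subgroup.zpowers (B p 1)).Normal := ⟨fun b hb g => by
    rwa [Subgroup.mem_center_iff.1 (Subgroup.zpowers_le.2 (B_mem_center 1) hb),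
      mul_inv_cancel_right]⟩
  obtain ⟨_, ⟨s, rfl⟩, _, ⟨t, rfl⟩, rfl⟩ := Subgroup.mem_sup_of_normal_right.1 hx
  exact ⟨s, t, rfl⟩

theorem commutatorElement_A_A_mem (i j : Fin 4) : ⁅A p i, A p j⁆ ∈ subgroupB p := by
  have key : ∀ i j : Fin 4, i < j → ⁅A p i, A p j⁆ ∈ subgroupB p := by
    have h (r : FreeGroup (Fin 4 ⊕ Fin 2)) (hr : r ∈ ({⁅α 0, α 1⁆ * (β 0)⁻¹, ⁅α 2, α 3⁆ * (β 0)⁻¹,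
        ⁅α 0, α 2⁆ * (β 1)⁻¹, ⁅α 1, α 3⁆ * (β 1 ^ leastPrimitiveRoot p)⁻¹, ⁅α 0, α 3⁆, ⁅α 1, α 2⁆,
        ⁅β 0, β 1⁆} : Set (FreeGroup (Fin 4 ⊕ Fin 2)))) : PresentedGroup.mk (relators p) r = 1 :=
      PresentedGroup.one_of_mem (Or.inl (Or.inl (Or.inl hr)))
    have h01 : ⁅A p 0, A p 1⁆ = B p 0 := mul_inv_eq_one.1 (h (⁅α 0, α 1⁆ * (β 0)⁻¹) (by simp))
    have h23 : ⁅A p 2, A p 3⁆ = B p 0 := mul_inv_eq_one.1 (h (⁅α 2, α 3⁆ * (β 0)⁻¹) (by simp))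
    have h02 : ⁅A p 0, A p 2⁆ = B p 1 := mul_inv_eq_one.1 (h (⁅α 0, α 2⁆ * (β 1)⁻¹) (by simp))
    have h13 : ⁅A p 1, A p 3⁆ = B p 1 ^ leastPrimitiveRoot p :=
      mul_inv_eq_one.1 (h (⁅α 1, α 3⁆ * (β 1 ^ leastPrimitiveRoot p)⁻¹) (by simp))
    have h03 : ⁅A p 0, A p 3⁆ = 1 := h ⁅α 0, α 3⁆ (by simp)
    have h12 : ⁅A p 1, A p 2⁆ = 1 := h ⁅α 1, α 2⁆ (by simp)
    intro i j hij
    fin_cases i <;> fin_cases j <;> first | exact absurd hij (by decide) | skip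
    · exact h01 ▸ B_mem 0
    · exact h02 ▸ B_mem 1
    · exact h03 ▸ one_mem _
    · exact h12 ▸ one_mem _
    · exact h13 ▸ pow_mem (B_mem 1) _
    · exact h23 ▸ B_mem 0
  rcases lt_trichotomy i j with hij | rfl | hij
  · exact key i j hij
  · rw [commutatorElement_self]
    exact one_mem _
  · rw [← commutatorElement_inv]
    exact inv_mem (key j i hij)

theorem commutator_le_subgroupB : commutator (StemGroup p) ≤ subgroupB p := by
  rw [← Subgroup.Normal.quotient_commutative_iff_commutator_le]
  have hgen (k l : Fin 4 ⊕ Fin 2) :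
      Commute (QuotientGroup.mk' (subgroupB p) (PresentedGroup.of k))
        (QuotientGroup.mk' (subgroupB p) (PresentedGroup.of l)) := by
    have hB (j : Fin 2) : QuotientGroup.mk' (subgroupB p) (PresentedGroup.of (Sum.inr j)) = 1 :=
      (QuotientGroup.eq_one_iff _).2 (B_mem j)
    rcases k with i | i
    · rcases l with j | j
      · rw [← commutatorElement_eq_one_iff_commute, ← map_commutatorElement]
        exact (QuotientGroup.eq_one_iff _).2 (commutatorElement_A_A_mem i j)
      · rw [hB]
        exact Commute.one_right _
    · rw [hB]
      exact Commute.one_left _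
  have hgen' (k : Fin 4 ⊕ Fin 2) (y : StemGroup p) :
      Commute (QuotientGroup.mk' (subgroupB p) (PresentedGroup.of k))
        (QuotientGroup.mk' (subgroupB p) y) := by
    have := PresentedGroup.generated_by (relators p) ((Subgroup.centralizer
      {QuotientGroup.mk' (subgroupB p) (PresentedGroup.of k)}).comap (QuotientGroup.mk' _))
      (fun l => Subgroup.mem_centralizer_singleton_iff.2 (hgen l k).eq) y
    exact (Subgroup.mem_centralizer_singleton_iff.1 this).symm
  refine ⟨⟨fun x y => ?_⟩⟩
  obtain ⟨x, rfl⟩ := QuotientGroup.mk'_surjective _ x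
  obtain ⟨y, rfl⟩ := QuotientGroup.mk'_surjective _ y
  have := PresentedGroup.generated_by (relators p) ((Subgroup.centralizer
    {QuotientGroup.mk' (subgroupB p) y}).comap (QuotientGroup.mk' _))
    (fun l => Subgroup.mem_centralizer_singleton_iff.2 (hgen' l y).eq) x
  exact Subgroup.mem_centralizer_singleton_iff.1 this

/-- Normal form: modulo the central subgroup `subgroupB p` the group is abelian. -/
theorem exists_eq_prod_zpow (x : StemGroup p) : ∃ (a b c d s t : ℤ),
    x = A p 3 ^ d * A p 2 ^ c * A p 1 ^ b * A p 0 ^ a * (B p 0 ^ s * B p 1 ^ t) := by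
  have hcomm := Subgroup.Normal.quotient_commutative_iff_commutator_le.2
    (commutator_le_subgroupB (p := p))
  let : CommGroup (StemGroup p ⧸ subgroupB p) :=
    { (inferInstance : Group (StemGroup p ⧸ subgroupB p)) with mul_comm := hcomm.is_comm.comm }
  let π : StemGroup p →* StemGroup p ⧸ subgroupB p := QuotientGroup.mk' (subgroupB p)
  let H : Subgroup (StemGroup p ⧸ subgroupB p) :=
    ((Subgroup.zpowers (π (A p 3)) ⊔ Subgroup.zpowers (π (A p 2))) ⊔
      Subgroup.zpowers (π (A p 1))) ⊔ Subgroup.zpowers (π (A p 0))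
  have hx : π x ∈ H := by
    refine PresentedGroup.generated_by (relators p) (H.comap π) (fun k => ?_) x
    rcases k with i | j
    · fin_cases i
      · exact Subgroup.mem_sup_right (Subgroup.mem_zpowers _)
      · exact Subgroup.mem_sup_left (Subgroup.mem_sup_right (Subgroup.mem_zpowers _))
      · exact Subgroup.mem_sup_left (Subgroup.mem_sup_left
          (Subgroup.mem_sup_right (Subgroup.mem_zpowers _)))
      · exact Subgroup.mem_sup_left (Subgroup.mem_sup_left
          (Subgroup.mem_sup_left (Subgroup.mem_zpowers _)))
    · have : π (B p j) = 1 := (QuotientGroup.eq_one_iff _).2 (B_mem j)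
      rw [Subgroup.mem_comap]
      change π (B p j) ∈ H
      rw [this]
      exact one_mem H
  obtain ⟨u, hu, _, ⟨a, rfl⟩, hx⟩ := Subgroup.mem_sup.1 hx
  obtain ⟨v, hv, _, ⟨b, rfl⟩, rfl⟩ := Subgroup.mem_sup.1 hu
  obtain ⟨_, ⟨d, rfl⟩, _, ⟨c, rfl⟩, rfl⟩ := Subgroup.mem_sup.1 hv
  simp only [← map_zpow, ← map_mul] at hx
  obtain ⟨s, t, hst⟩ := exists_zpow_of_mem_subgroupB (QuotientGroup.eq.1 hx)
  exact ⟨a, b, c, d, s, t, by rw [← hst, mul_inv_cancel_left]⟩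

/-- With the factors in descending order all cocycle terms vanish. -/
theorem toModel_prod (a b c d s t : ℤ) :
    toModel p (A p 3 ^ d * A p 2 ^ c * A p 1 ^ b * A p 0 ^ a * (B p 0 ^ s * B p 1 ^ t)) =
      ⟨a, b, c, d, s, t⟩ := by
  have hA (i) : toModel p (A p i) = modelGen _ (Sum.inl i) := PresentedGroup.toGroup.of _
  have hB (i) : toModel p (B p i) = modelGen _ (Sum.inr i) := PresentedGroup.toGroup.of _
  simp only [map_mul, map_zpow, hA, hB, modelGen_zpow, Phi15Model.mul_def]
  simp [modelGen]

/-- The model computes the exponents of the normal form modulo `p`, and the generators have exponent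
`p`. -/
theorem toModel_bijective (hp : p.Prime) : Function.Bijective (toModel p) := by
  have := Fact.mk hp
  constructor
  · rw [← MonoidHom.ker_eq_bot_iff, Subgroup.eq_bot_iff_forall]
    intro x hx
    obtain ⟨a, b, c, d, s, t, rfl⟩ := exists_eq_prod_zpow x
    rw [MonoidHom.mem_ker, toModel_prod, Phi15Model.one_def, Phi15Model.mk.injEq] at hx
    simp only [ZMod.intCast_zmod_eq_zero_iff_dvd] at hx
    have key {x : StemGroup p} (hx : x ^ p = 1) {n : ℤ} (hn : (p : ℤ) ∣ n) : x ^ n = 1 := by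
      obtain ⟨k, rfl⟩ := hn
      rw [zpow_mul, zpow_natCast, hx, one_zpow]
    obtain ⟨ha, hb, hc, hd, hs, ht⟩ := hx
    rw [key (A_pow _) ha, key (A_pow _) hb, key (A_pow _) hc, key (A_pow _) hd,
      key (B_pow _) hs, key (B_pow _) ht]
    simp
  · rintro ⟨a, b, c, d, s, t⟩
    obtain ⟨a, rfl⟩ := ZMod.intCast_surjective a
    obtain ⟨b, rfl⟩ := ZMod.intCast_surjective b
    obtain ⟨c, rfl⟩ := ZMod.intCast_surjective c
    obtain ⟨d, rfl⟩ := ZMod.intCast_surjective d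
    obtain ⟨s, rfl⟩ := ZMod.intCast_surjective s
    obtain ⟨t, rfl⟩ := ZMod.intCast_surjective t
    exact ⟨_, toModel_prod a b c d s t⟩

/-- The isomorphism of `Φ₁₅(1⁶)` with its model. -/
noncomputable def equivModel (hp : p.Prime) :
    StemGroup p ≃* Phi15Model (leastPrimitiveRoot p : ZMod p) :=
  MulEquiv.ofBijective (toModel p) (toModel_bijective hp)

end Phi15

/-! ### Properties of `Φ₁₅(1⁶)` -/

theorem MulEquiv.mem_center_iff {G H : Type*} [Group G] [Group H] (e : G ≃* H) {g : G} :
    e g ∈ Subgroup.center H ↔ g ∈ Subgroup.center G := by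
  rw [Subgroup.mem_center_iff, Subgroup.mem_center_iff]
  refine ⟨fun h x => e.injective ?_, fun h y => ?_⟩
  · rw [map_mul, map_mul, h]
  · obtain ⟨x, rfl⟩ := e.surjective y
    rw [← map_mul, ← map_mul, h]

namespace Phi15

variable {p : ℕ}

theorem commutator_eq_center (hp : p.Prime) (hp3 : 3 ≤ p) :
    commutator (StemGroup p) = Subgroup.center (StemGroup p) := by
  have := Fact.mk hp
  let e := equivModel hp
  have h1 : (commutator (StemGroup p)).map e.toMonoidHom = commutator (Phi15Model _) := by
    rw [commutator_def, commutator_def, Subgroup.map_commutator,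
      Subgroup.map_top_of_surjective e.toMonoidHom e.surjective]
  have h2 : (Subgroup.center (StemGroup p)).map e.toMonoidHom =
      Subgroup.center (Phi15Model _) := by
    ext y
    obtain ⟨x, rfl⟩ := e.surjective y
    rw [e.mem_center_iff]
    exact Subgroup.mem_map_iff_mem (f := e.toMonoidHom) e.injective
  refine Subgroup.map_injective (f := e.toMonoidHom) e.injective ?_
  rw [h1, h2, Phi15Model.commutator_eq_center (not_isSquare_leastPrimitiveRoot hp hp3)]

theorem card_stemGroup (hp : p.Prime) : Nat.card (StemGroup p) = p ^ 6 := by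
  rw [Nat.card_congr (equivModel hp).toEquiv, Phi15Model.card_eq, Nat.card_zmod]

theorem card_center (hp : p.Prime) (hp3 : 3 ≤ p) :
    Nat.card (Subgroup.center (StemGroup p)) = p ^ 2 := by
  have := Fact.mk hp
  have h := Phi15Model.card_center (not_isSquare_leastPrimitiveRoot hp hp3)
  rw [Nat.card_zmod] at h
  rw [← h]
  exact Nat.card_congr ((equivModel hp).toEquiv.subtypeEquiv fun g =>
    ((equivModel hp).mem_center_iff).symm)

theorem exists_commutatorElement_eq (hp : p.Prime) (hp3 : 3 ≤ p) {g z : StemGroup p}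
    (hg : g ∉ Subgroup.center (StemGroup p)) (hz : z ∈ commutator (StemGroup p)) :
    ∃ y, ⁅g, y⁆ = z := by
  have := Fact.mk hp
  have hω := not_isSquare_leastPrimitiveRoot hp hp3
  let e := equivModel hp
  rw [commutator_eq_center hp hp3, ← e.mem_center_iff] at hz
  obtain ⟨h1, h2, h3, h4⟩ := (Phi15Model.mem_center_iff hω).1 hz
  obtain ⟨y, hy⟩ := Phi15Model.exists_commutatorElement_eq hω (e g)
    (fun h => hg (e.mem_center_iff.1 ((Phi15Model.mem_center_iff hω).2 h))) (e z).s (e z).t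
  refine ⟨e.symm y, e.injective ?_⟩
  rw [map_commutatorElement, e.apply_symm_apply, hy]
  ext <;> simp [*]

end Phi15

/-! ### Invariance under isoclinism -/

section Isoclinism

variable {G H : Type*} [Group G] [Group H]

theorem IsIsoclinic.commutator_le_center (h : IsIsoclinic G H)
    (hH : commutator H ≤ Subgroup.center H) : commutator G ≤ Subgroup.center G := by
  obtain ⟨φ, -, -⟩ := h
  rw [← Subgroup.Normal.quotient_commutative_iff_commutator_le] at hH ⊢
  refine ⟨⟨fun x y => φ.injective ?_⟩⟩
  rw [map_mul, map_mul, hH.is_comm.comm]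

theorem IsIsoclinic.exists_commutatorElement_eq (h : IsIsoclinic G H)
    (hH : ∀ g ∉ Subgroup.center H, ∀ z ∈ commutator H, ∃ y, ⁅g, y⁆ = z)
    {g z : G} (hg : g ∉ Subgroup.center G) (hz : z ∈ commutator G) : ∃ y, ⁅g, y⁆ = z := by
  obtain ⟨φ, ψ, hφψ⟩ := h
  obtain ⟨g', hg'⟩ := QuotientGroup.mk_surjective (φ (QuotientGroup.mk g))
  have hgZ : g' ∉ Subgroup.center H := by
    rwa [← QuotientGroup.eq_one_iff, hg', map_eq_one_iff φ φ.injective, QuotientGroup.eq_one_iff]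
  obtain ⟨y', hy'⟩ := hH g' hgZ _ (ψ ⟨z, hz⟩).2
  obtain ⟨y, hy⟩ := QuotientGroup.mk_surjective (φ.symm (QuotientGroup.mk y'))
  refine ⟨y, congrArg Subtype.val (?_ : (⟨⁅g, y⁆, Subgroup.commutator_mem_commutator
    (Subgroup.mem_top g) (Subgroup.mem_top y)⟩ : commutator G) = ⟨z, hz⟩)⟩
  refine ψ.injective (Subtype.ext ?_)
  rw [hφψ g y g' y' hg'.symm (by rw [hy, φ.apply_symm_apply]), hy']

theorem IsIsoclinic.index_center_eq (h : IsIsoclinic G H) :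
    (Subgroup.center G).index = (Subgroup.center H).index := by
  obtain ⟨φ, -, -⟩ := h
  exact Nat.card_congr φ.toEquiv

theorem IsIsoclinic.card_commutator_eq (h : IsIsoclinic G H) :
    Nat.card (commutator G) = Nat.card (commutator H) := by
  obtain ⟨-, ψ, -⟩ := h
  exact Nat.card_congr ψ.toEquiv

end Isoclinism

theorem not_isExceptionalGroup_of_isInPhi15 {p : ℕ} (hp : p.Prime) (hp5 : 5 ≤ p) {G : Type*}
    [Group G] [Finite G] (h : IsInPhi15 p G) : ¬ IsExceptionalGroup G := by
  obtain ⟨hG, hiso⟩ := h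
  have hp3 : 3 ≤ p := by omega
  have hcenter := Phi15.commutator_eq_center hp hp3
  refine not_isExceptionalGroup hp hp5 hG ?_ (hiso.commutator_le_center hcenter.le)
    (fun g hg z hz => hiso.exists_commutatorElement_eq
      (fun g hg z hz => Phi15.exists_commutatorElement_eq hp hp3 hg hz) hg hz) fun hc => ?_
  · have h1 := (Subgroup.center G).card_mul_index
    have h2 := (Subgroup.center (Phi15.StemGroup p)).card_mul_index
    rw [hiso.index_center_eq, hG, ← Phi15.card_stemGroup hp, ← h2, Phi15.card_center hp hp3] at h1
    refine Nat.eq_of_mul_eq_mul_right (Nat.pos_of_ne_zero fun h0 => ?_) h1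
    rw [h0, mul_zero, Phi15.card_stemGroup hp] at h2
    exact pow_ne_zero 6 hp.ne_zero h2.symm
  · rw [hiso.card_commutator_eq, hcenter, Phi15.card_center hp hp3] at hc
    nlinarith [hp.one_lt]

theorem lemma3p1 (p : ℕ) (hp : p.Prime) (hp5 : 5 ≤ p) (G : Type*) [Group G] [Finite G] :
    (Nat.card G = p ^ 6 → IsVZGroup G →
      Group.rank (Subgroup.center G) = Group.rank (commutator G) →
      Nat.card (Subgroup.center G) = p ^ 2 →
      ¬ IsExceptionalGroup G) ∧
    (IsInPhi15 p G → ¬ IsExceptionalGroup G) :=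
  ⟨fun hG hVZ hrank hZ => not_isExceptionalGroup_of_isVZGroup hp hp5 hG hVZ hrank hZ,
    not_isExceptionalGroup_of_isInPhi15 hp hp5⟩
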